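/- Let $\mathbb T=\mathbb R/\mathbb Z$ with Lebesgue measure $\lambda$, let $\alpha\in\mathbb R$ be irrational and $Tx=x+\alpha$. For a group-valued function $f$ on $\mathbb T$ put $f^{(n)}(x)=f(x)f(Tx)\cdots f(T^{n-1}x)$ for $n\ge 1$ and $f^{(0)}=e$. For a $2\times 2$ matrix $A$ put $\|A\|=\bigl(\tfrac12\sum_{i,j}|a_{ij}|^2\bigr)^{1/2}$. If $\varphi:\mathbb T\to SU(2)$ is of class $C^1$, the functions $\tfrac1n D\varphi^{(n)}(\varphi^{(n)})^{-1}$ converge in $L^2(\mathbb T,\mathfrak{su}(2))$ to a function $\psi$ for which $\|\psi(x)\|$ is almost everywhere equal to a constant; this constant is called the degree $d(\varphi)$. Measurable functions $\varphi,\varphi':\mathbb T\to SU(2)$ are cohomologous if there is a measurable $p:\mathbb T\to SU(2)$ with $\varphi(x)=p(x)^{-1}\varphi'(x)p(Tx)$ for almost every $x$. Let $S^1=\{z\in\mathbb C:|z|=1\}$ with normalized Haar measure $\mu$. **Theorem 5.3.** Let $\varphi:\mathbb T\to SU(2)$ be of class $C^1$ with $d(\varphi)\neq 0$. Then there is a measurable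 $\gamma:\mathbb T\to S^1$ such that $\varphi$ is cohomologous to the diagonal cocycle $\operatorname{diag}(\gamma,\overline{\gamma})$. For every such $\gamma$ the skew product $T_\gamma(x,z)=(x+\alpha,\,z\gamma(x))$ on $(\mathbb T\times S^1,\lambda\otimes\mu)$ is ergodic, and it is mixing on the orthocomplement in $L^2(\mathbb T\times S^1,\lambda\otimes\mu)$ of the space of functions depending only on the first variable: $\langle f\circ T_\gamma^n,f\rangle\to 0$ as $n\to\infty$ for every $f$ in this orthocomplement. Moreover, $\lim_{n\to\infty}\int_{\mathbb T}(\gamma^{(n)}(x))^k\,dx=0$ for every integer $k\neq 0$. -/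

import Mathlib

open MeasureTheory Filter Topology
open scoped ENNReal ComplexConjugate

noncomputable section

/-! ### Cocycles, skew products, Koopman operators -/

/-- The special unitary group `SU(2)`. -/
abbrev SU2 : Type := Matrix.specialUnitaryGroup (Fin 2) ℂ

/-- The rotation `T x = x + α` of the circle `ℝ / ℤ`. -/
def circleRotation (α : ℝ) (x : UnitAddCircle) : UnitAddCircle := x + (α : UnitAddCircle)

/-- The cocycle `φ^(n)(x) = φ(x) φ(T x) ⋯ φ(T^(n-1) x)`, for `n ≥ 0`. -/
def cocycleIter {X G : Type*} [Group G] (T : X → X) (φ : X → G) : ℕ → X → G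
  | 0, _ => 1
  | n + 1, x => cocycleIter T φ n x * φ (T^[n] x)

/-- The skew product `T_φ (x, g) = (T x, g φ(x))`. -/
def skewProduct {X G : Type*} [Group G] (T : X → X) (φ : X → G) (z : X × G) : X × G :=
  (T z.1, z.2 * φ z.1)

/-- The unit circle in `ℂ` carries its Borel σ-algebra. -/
instance instMeasurableSpaceUnitCircle : MeasurableSpace Circle := borel Circle

instance instBorelSpaceUnitCircle : BorelSpace Circle := ⟨rfl⟩

/-- Normalized Haar measure on the unit circle in `ℂ`. -/
def circleHaar : Measure Circle := Measure.haarMeasure ⊤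

instance instIsHaarMeasureCircleHaar : circleHaar.IsHaarMeasure := by
  unfold circleHaar; infer_instance

instance instIsProbabilityMeasureCircleHaar : IsProbabilityMeasure circleHaar :=
  ⟨by simpa [circleHaar] using
    Measure.haarMeasure_self (K₀ := (⊤ : TopologicalSpace.PositiveCompacts Circle))⟩

instance instIsProbabilityMeasureUnitAddCircle :
    IsProbabilityMeasure (volume : Measure UnitAddCircle) :=
  ⟨by simp⟩

/-- The product of Lebesgue measure on `ℝ / ℤ` with Haar measure on the unit circle. -/
def torusMeasure : Measure (UnitAddCircle × Circle) := volume.prod circleHaar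

theorem measurePreserving_circleRotation (α : ℝ) :
    MeasurePreserving (circleRotation α) volume volume :=
  measurePreserving_add_right volume (α : UnitAddCircle)

theorem measurePreserving_skewProduct (α : ℝ) {γ : UnitAddCircle → Circle} (hγ : Measurable γ) :
    MeasurePreserving (skewProduct (circleRotation α) γ) torusMeasure torusMeasure := by
  refine (measurePreserving_circleRotation α).skew_product (g := fun x z => z * γ x)
    (measurable_snd.mul (hγ.comp measurable_fst)) (ae_of_all _ fun x => ?_)
  exact (measurePreserving_mul_right circleHaar (γ x)).map_eq

/-- The Koopman operator `f ↦ f ∘ S` on `L²` of a measure preserving map `S`. -/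
def koopman {X Y : Type*} [MeasurableSpace X] [MeasurableSpace Y] {μ : Measure X} {ν : Measure Y}
    {S : X → Y} (hS : MeasurePreserving S μ ν) : Lp ℂ 2 ν →ₗᵢ[ℂ] Lp ℂ 2 μ :=
  Lp.compMeasurePreservingₗᵢ ℂ S hS

/-- The functions in `L²` of the torus that depend only on the first variable, that is, the
functions `(x, z) ↦ h x` with `h` in `L²` of the circle. -/
def firstVariableFunctions : Submodule ℂ (Lp ℂ 2 torusMeasure) :=
  LinearMap.range (koopman (measurePreserving_fst (μ := (volume : Measure UnitAddCircle))
    (ν := circleHaar))).toLinearMap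

/-- The operator `U` is mixing on the subspace `K`: `(Uⁿ f, f) → 0` for all `f` in `K`. -/
def IsMixingOn {H : Type*} [NormedAddCommGroup H] [InnerProductSpace ℂ H] (U : H →ₗᵢ[ℂ] H)
    (K : Submodule ℂ H) : Prop :=
  ∀ f ∈ K, Tendsto (fun n : ℕ => inner ℂ f (U^[n] f)) atTop (𝓝 0)

/-! ### Cocycles with values in `SU(2)` -/

/-- `φ : ℝ / ℤ → SU(2)` is of class `C¹`: the entries of its lift to `ℝ` are. -/
def IsC1Cocycle (φ : UnitAddCircle → SU2) : Prop :=
  ∀ i j, ContDiff ℝ 1 fun t : ℝ => (φ (t : UnitAddCircle)).1 i j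

/-- `φ` and `ψ` are cohomologous over the rotation by `α`: there is a measurable
transfer function `p` with `φ(x) = p(x)⁻¹ ψ(x) p(T x)` almost everywhere. -/
def IsCohomologous (α : ℝ) (φ ψ : UnitAddCircle → SU2) : Prop :=
  ∃ p : UnitAddCircle → SU2, (∀ i j, Measurable fun x => (p x).1 i j) ∧
    ∀ᵐ x, φ x = (p x)⁻¹ * ψ x * p (circleRotation α x)

/-- The diagonal matrix with entries `z` and its conjugate, for `|z| = 1`. -/
def diagSU2 (z : Circle) : SU2 :=
  ⟨!![(z : ℂ), 0; 0, conj (z : ℂ)], by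
    have h : (z : ℂ) * conj (z : ℂ) = 1 := by simp [Complex.mul_conj]
    have h' : conj (z : ℂ) * (z : ℂ) = 1 := by rw [mul_comm]; exact h
    rw [Matrix.mem_specialUnitaryGroup_iff, Matrix.mem_unitaryGroup_iff]
    refine ⟨?_, by simp [Matrix.det_fin_two, h]⟩
    ext i j
    fin_cases i <;> fin_cases j <;>
      simp [Matrix.mul_apply, Fin.sum_univ_two, Matrix.star_apply, h, h']⟩

/-- The entrywise derivative of a matrix valued function on `ℝ / ℤ`. -/
def circleDeriv (F : UnitAddCircle → Matrix (Fin 2) (Fin 2) ℂ) (x : UnitAddCircle) :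
    Matrix (Fin 2) (Fin 2) ℂ :=
  Matrix.of fun i j => deriv (fun t : ℝ => F (x + (t : UnitAddCircle)) i j) 0

/-- The norm `‖A‖ = (½ ∑ |a_ij|²)^{1/2}`. -/
def su2Norm (A : Matrix (Fin 2) (Fin 2) ℂ) : ℝ :=
  √((1 / 2) * ∑ i, ∑ j, ‖A i j‖ ^ 2)

/-- The function `(1/n) Dφ^(n) (φ^(n))⁻¹`. -/
def meanLogDeriv (α : ℝ) (φ : UnitAddCircle → SU2) (n : ℕ) (x : UnitAddCircle) :
    Matrix (Fin 2) (Fin 2) ℂ :=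
  (n : ℂ)⁻¹ • (circleDeriv (fun y => (cocycleIter (circleRotation α) φ n y).1) x *
    ((cocycleIter (circleRotation α) φ n x)⁻¹ : SU2).1)

/-- `d` is the degree of `φ` over the rotation by `α`: the functions `(1/n) Dφ^(n) (φ^(n))⁻¹`
converge in `L²` to a function `ψ` whose norm is almost everywhere the constant `d`.
(As these functions have values in the Lie algebra `su(2)`, so has `ψ`, almost everywhere.) -/
def HasDegree (α : ℝ) (φ : UnitAddCircle → SU2) (d : ℝ) : Prop :=
  ∃ ψ : UnitAddCircle → Matrix (Fin 2) (Fin 2) ℂ, (∀ i j, Measurable fun x => ψ x i j) ∧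
    Tendsto (fun n : ℕ => ∫⁻ x, ENNReal.ofReal (su2Norm (meanLogDeriv α φ n x - ψ x) ^ 2))
      atTop (𝓝 0) ∧
    ∀ᵐ x, su2Norm (ψ x) = d

/-! ### Existence and uniqueness of the degree -/

namespace DegreeExistence

abbrev M := Matrix (Fin 2) (Fin 2) ℂ
abbrev E := EuclideanSpace ℂ (Fin 2 × Fin 2)

abbrev L2E := Lp E 2 (volume : Measure UnitAddCircle)

def vec (A : M) : E := WithLp.toLp 2 fun ij => A ij.1 ij.2
def unvec (v : E) : M := Matrix.of fun i j => v (i, j)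

theorem vec_unvec (v : E) : vec (unvec v) = v := by ext ⟨i, j⟩; rfl
theorem unvec_vec (A : M) : unvec (vec A) = A := rfl
theorem continuous_vec : Continuous vec :=
  (PiLp.continuous_toLp 2 _).comp (continuous_pi fun ij => by fun_prop)
theorem continuous_unvec : Continuous unvec :=
  continuous_matrix fun i j => by unfold unvec; simp only [Matrix.of_apply]; fun_prop

theorem norm_vec_sq (A : M) : ‖vec A‖ ^ 2 = 2 * su2Norm A ^ 2 := by
  rw [su2Norm, Real.sq_sqrt (by positivity), EuclideanSpace.norm_sq_eq, Fintype.sum_prod_type]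
  simp [vec]

theorem su2Norm_nonneg (A : M) : 0 ≤ su2Norm A := Real.sqrt_nonneg _

theorem norm_vec (A : M) : ‖vec A‖ = √2 * su2Norm A := by
  have h := su2Norm_nonneg A
  rw [← sq_eq_sq₀ (norm_nonneg _) (by positivity), norm_vec_sq, mul_pow,
    Real.sq_sqrt (by norm_num)]

/-- The adjoint action. -/
def Ad (u : SU2) (A : M) : M := u.1 * A * (u⁻¹ : SU2).1

theorem coe_inv (u : SU2) : (u⁻¹ : SU2).1 = star u.1 := rfl
theorem inv_mul_coe (u : SU2) : (u⁻¹ : SU2).1 * u.1 = 1 := by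
  have := congrArg Subtype.val (inv_mul_cancel u); exact this
theorem mul_inv_coe (u : SU2) : u.1 * (u⁻¹ : SU2).1 = 1 := by
  have := congrArg Subtype.val (mul_inv_cancel u); exact this

theorem Ad_mul (u v : SU2) (A : M) : Ad (u * v) A = Ad u (Ad v A) := by
  unfold Ad; rw [mul_inv_rev]; simp [Matrix.mul_assoc]
theorem Ad_one (A : M) : Ad 1 A = A := by
  unfold Ad; rw [inv_one]; simp
theorem Ad_add (u : SU2) (A B : M) : Ad u (A + B) = Ad u A + Ad u B := by
  simp [Ad, mul_add, add_mul]
theorem Ad_smul (u : SU2) (c : ℂ) (A : M) : Ad u (c • A) = c • Ad u A := by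
  simp [Ad]

theorem sum_sq_eq (A : M) :
    ((∑ i, ∑ j, ‖A i j‖ ^ 2 : ℝ) : ℂ) = Matrix.trace (A * star A) := by
  simp [Matrix.trace, Matrix.mul_apply, Matrix.star_apply, Complex.mul_conj, Complex.normSq_eq_norm_sq]

theorem su2Norm_Ad (u : SU2) (A : M) : su2Norm (Ad u A) = su2Norm A := by
  have : (∑ i, ∑ j, ‖Ad u A i j‖ ^ 2 : ℝ) = ∑ i, ∑ j, ‖A i j‖ ^ 2 := by
    have h : Matrix.trace (Ad u A * star (Ad u A)) = Matrix.trace (A * star A) := by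
      have h1 : Ad u A * star (Ad u A) = u.1 * (A * star A * (u⁻¹ : SU2).1) := by
        unfold Ad
        simp only [star_mul, coe_inv, star_star]
        have h2 : star u.1 * u.1 = 1 := inv_mul_coe u
        calc u.1 * A * star u.1 * (u.1 * (star A * star u.1))
            = u.1 * A * (star u.1 * u.1) * (star A * star u.1) := by noncomm_ring
          _ = _ := by rw [h2]; noncomm_ring
      rw [h1, Matrix.trace_mul_comm, mul_assoc, inv_mul_coe, mul_one]
    exact_mod_cast (sum_sq_eq _).trans (h.trans (sum_sq_eq A).symm)
  unfold su2Norm; rw [this]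

/-! Derivatives -/

def Diff (F : UnitAddCircle → M) : Prop :=
  ∀ x i j, DifferentiableAt ℝ (fun t : ℝ => F (x + (t : UnitAddCircle)) i j) 0

theorem hasDeriv {F : UnitAddCircle → M} (hF : Diff F) (x i j) :
    HasDerivAt (fun t : ℝ => F (x + (t : UnitAddCircle)) i j) (circleDeriv F x i j) 0 :=
  (hF x i j).hasDerivAt

theorem hasDeriv_mul {F G : UnitAddCircle → M} (hF : Diff F) (hG : Diff G) (x i j) :
    HasDerivAt (fun t : ℝ => (F (x + (t : UnitAddCircle)) * G (x + (t : UnitAddCircle))) i j)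
      ((circleDeriv F x * G x + F x * circleDeriv G x) i j) 0 := by
  have h := HasDerivAt.fun_sum (u := Finset.univ) fun (k : Fin 2) _ =>
    (hasDeriv hF x i k).mul (hasDeriv hG x k j)
  simp only [AddCircle.coe_zero, add_zero] at h
  simpa [Matrix.mul_apply, Finset.sum_add_distrib] using h

theorem Diff.mul {F G : UnitAddCircle → M} (hF : Diff F) (hG : Diff G) :
    Diff fun x => F x * G x := fun x i j => (hasDeriv_mul hF hG x i j).differentiableAt

theorem circleDeriv_mul {F G : UnitAddCircle → M} (hF : Diff F) (hG : Diff G) (x) :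
    circleDeriv (fun x => F x * G x) x = circleDeriv F x * G x + F x * circleDeriv G x := by
  ext i j; exact (hasDeriv_mul hF hG x i j).deriv

theorem circleDeriv_add_const (F : UnitAddCircle → M) (a x : UnitAddCircle) :
    circleDeriv (fun x => F (x + a)) x = circleDeriv F (x + a) := by
  ext i j; simp only [circleDeriv, Matrix.of_apply, add_right_comm]

theorem Diff.add_const {F : UnitAddCircle → M} (hF : Diff F) (a : UnitAddCircle) :
    Diff fun x => F (x + a) := fun x i j => by
  simpa only [add_right_comm] using hF (x + a) i j

theorem circleRotation_iterate (α : ℝ) (n : ℕ) (x : UnitAddCircle) :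
    (circleRotation α)^[n] x = x + n • (α : UnitAddCircle) := by
  induction n with
  | zero => simp
  | succ n ih => rw [Function.iterate_succ_apply', ih, circleRotation, succ_nsmul, add_assoc]

theorem circleDeriv_coe (F : UnitAddCircle → M) (s : ℝ) (i j) :
    circleDeriv F s i j = deriv (fun t : ℝ => F t i j) s := by
  have := deriv_comp_const_add (fun t : ℝ => F (t : UnitAddCircle) i j) s 0
  simpa [circleDeriv] using this

theorem continuous_of_lift {Y : Type*} [TopologicalSpace Y] {f : UnitAddCircle → Y}
    (h : Continuous fun t : ℝ => f t) : Continuous f :=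
  continuous_coinduced_dom.2 h

variable {α : ℝ} {φ : UnitAddCircle → SU2}

theorem continuous_coe (hφ : IsC1Cocycle φ) : Continuous fun x => (φ x).1 :=
  continuous_of_lift (continuous_matrix fun i j => (hφ i j).continuous)

theorem diff_coe (hφ : IsC1Cocycle φ) : Diff fun x => (φ x).1 := fun x i j => by
  obtain ⟨s, rfl⟩ := QuotientAddGroup.mk_surjective x
  have h : Differentiable ℝ fun t : ℝ => (φ (t : UnitAddCircle)).1 i j :=
    (hφ i j).differentiable one_ne_zero
  exact (h.comp (differentiable_id.const_add s)).differentiableAt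

theorem continuous_deriv (hφ : IsC1Cocycle φ) : Continuous (circleDeriv fun x => (φ x).1) := by
  refine continuous_of_lift (continuous_matrix fun i j => ?_)
  simp only [circleDeriv_coe]
  exact (hφ i j).continuous_deriv le_rfl

abbrev cyc (α : ℝ) (φ : UnitAddCircle → SU2) := cocycleIter (circleRotation α) φ

/-- The function `Dφ φ⁻¹`. -/
def logDeriv (φ : UnitAddCircle → SU2) (x : UnitAddCircle) : M :=
  circleDeriv (fun y => (φ y).1) x * ((φ x)⁻¹ : SU2).1

theorem continuous_logDeriv (hφ : IsC1Cocycle φ) : Continuous (logDeriv φ) :=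
  (continuous_deriv hφ).matrix_mul (continuous_coe hφ).matrix_conjTranspose

theorem diff_cyc (hφ : IsC1Cocycle φ) (n : ℕ) : Diff fun x => (cyc α φ n x).1 := by
  induction n with
  | zero => intro x i j; simp [cocycleIter]
  | succ n ih =>
    have := ih.mul ((diff_coe hφ).add_const (n • (α : UnitAddCircle)))
    simpa [Diff, cocycleIter, circleRotation_iterate] using this

theorem logDeriv_cyc (hφ : IsC1Cocycle φ) (n : ℕ) (x : UnitAddCircle) :
    logDeriv (cyc α φ n) x =
      ∑ k ∈ Finset.range n, Ad (cyc α φ k x) (logDeriv φ ((circleRotation α)^[k] x)) := by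
  induction n with
  | zero => ext i j; simp [logDeriv, circleDeriv, cocycleIter, Matrix.mul_apply]
  | succ n ih =>
    rw [Finset.sum_range_succ, ← ih]
    have h1 : (fun y => (cyc α φ (n + 1) y).1) =
        fun y => (cyc α φ n y).1 * (φ (y + n • (α : UnitAddCircle))).1 := by
      funext y; simp [cocycleIter, circleRotation_iterate]
    have h2 : ((cyc α φ (n + 1) x)⁻¹ : SU2).1 =
        ((φ (x + n • (α : UnitAddCircle)))⁻¹ : SU2).1 * ((cyc α φ n x)⁻¹ : SU2).1 := by
      simp [cocycleIter, circleRotation_iterate, mul_inv_rev]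
    unfold logDeriv
    rw [h1, h2, circleDeriv_mul (diff_cyc hφ n) ((diff_coe hφ).add_const _),
      circleDeriv_add_const (fun y => (φ y).1), circleRotation_iterate]
    unfold Ad
    have h3 := mul_inv_coe (φ (x + n • (α : UnitAddCircle)))
    rw [add_mul]
    congr 1
    · rw [mul_assoc, ← mul_assoc _ _ ((cyc α φ n x)⁻¹ : SU2).1, h3, one_mul]
    · noncomm_ring

/-! The operator `U f (x) = Ad_{φ(x)} f (T x)` -/

theorem continuous_act (hφ : IsC1Cocycle φ) :
    Continuous fun z : UnitAddCircle × E => vec (Ad (φ z.1) (unvec z.2)) := by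
  have h := (continuous_coe hφ).comp (continuous_fst (X := UnitAddCircle) (Y := E))
  exact continuous_vec.comp ((h.matrix_mul (continuous_unvec.comp continuous_snd)).matrix_mul
    h.matrix_conjTranspose)

theorem norm_act (u : SU2) (v : E) : ‖vec (Ad u (unvec v))‖ = ‖v‖ := by
  rw [norm_vec, su2Norm_Ad, ← norm_vec, vec_unvec]

theorem memLp_act (hφ : IsC1Cocycle φ) {f : UnitAddCircle → E} (hf : MemLp f 2 volume) :
    MemLp (fun x => vec (Ad (φ x) (unvec (f (circleRotation α x))))) 2 volume := by
  have h := hf.comp_measurePreserving (measurePreserving_circleRotation α)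
  have h1 : AEStronglyMeasurable (fun x => (x, f (circleRotation α x))) volume :=
    (continuous_id.aestronglyMeasurable (α := UnitAddCircle)).prodMk h.1
  have h2 := (continuous_act hφ).comp_aestronglyMeasurable h1
  have h3 : ∀ x, ‖vec (Ad (φ x) (unvec (f (circleRotation α x))))‖ ≤
      ‖(f ∘ circleRotation α) x‖ := fun x => (norm_act _ _).le
  exact h.of_le h2 (ae_of_all _ h3)

def opU (α : ℝ) (hφ : IsC1Cocycle φ) : L2E →ₗᵢ[ℂ]
    L2E where
  toFun f := (memLp_act (α := α) hφ (Lp.memLp f)).toLp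
  map_add' f g := by
    rw [← MemLp.toLp_add]
    refine MemLp.toLp_congr _ _ ?_
    filter_upwards [(measurePreserving_circleRotation α).quasiMeasurePreserving.ae_eq_comp
      (Lp.coeFn_add f g)] with x hx
    simp only [Function.comp_apply, Pi.add_apply] at hx ⊢
    rw [hx]
    have : ∀ v w : E, vec (Ad (φ x) (unvec (v + w))) =
        vec (Ad (φ x) (unvec v)) + vec (Ad (φ x) (unvec w)) := fun v w => by
      have h : unvec (v + w) = unvec v + unvec w := rfl
      rw [h, Ad_add]; rfl
    exact this _ _
  map_smul' c f := by
    rw [RingHom.id_apply, ← MemLp.toLp_const_smul]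
    refine MemLp.toLp_congr _ _ ?_
    filter_upwards [(measurePreserving_circleRotation α).quasiMeasurePreserving.ae_eq_comp
      (Lp.coeFn_smul c f)] with x hx
    simp only [Function.comp_apply, Pi.smul_apply] at hx ⊢
    rw [hx]
    have : ∀ v : E, vec (Ad (φ x) (unvec (c • v))) = c • vec (Ad (φ x) (unvec v)) := fun v => by
      have h : unvec (c • v) = c • unvec v := rfl
      rw [h, Ad_smul]; rfl
    exact this _
  norm_map' f := by
    change ‖(memLp_act (α := α) hφ (Lp.memLp f)).toLp‖ = ‖f‖
    rw [Lp.norm_toLp, Lp.norm_def]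
    congr 1
    rw [← eLpNorm_comp_measurePreserving (Lp.aestronglyMeasurable f)
      (measurePreserving_circleRotation α)]
    refine eLpNorm_congr_norm_ae (ae_of_all _ fun x => ?_)
    rw [norm_act]; rfl

theorem coeFn_opU (hφ : IsC1Cocycle φ) (f : L2E) :
    opU α hφ f =ᵐ[volume] fun x => vec (Ad (φ x) (unvec (f (circleRotation α x)))) :=
  MemLp.coeFn_toLp (memLp_act (α := α) hφ (Lp.memLp f))

theorem coeFn_opU_iterate (hφ : IsC1Cocycle φ) (n : ℕ) :
    ∀ f : L2E, (opU α hφ)^[n] f =ᵐ[volume]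
      fun x => vec (Ad (cyc α φ n x) (unvec (f ((circleRotation α)^[n] x)))) := by
  induction n with
  | zero => intro f; exact ae_of_all _ fun x => by simp [cocycleIter, Ad_one, vec_unvec]
  | succ n ih =>
    intro f
    rw [Function.iterate_succ_apply]
    have h := ((measurePreserving_circleRotation α).iterate n).quasiMeasurePreserving.ae_eq_comp
      (coeFn_opU (α := α) hφ f)
    filter_upwards [ih (opU α hφ f), h] with x h1 h2
    rw [h1]
    simp only [Function.comp_apply] at h2
    rw [h2, unvec_vec, ← Ad_mul, ← Function.iterate_succ_apply' (circleRotation α)]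
    rfl

theorem memLp_logDeriv (hφ : IsC1Cocycle φ) :
    MemLp (fun x => vec (logDeriv φ x)) 2 (volume : Measure UnitAddCircle) :=
  (continuous_vec.comp (continuous_logDeriv hφ)).memLp_of_hasCompactSupport
    (HasCompactSupport.of_compactSpace _)

theorem coeFn_birkhoff (hφ : IsC1Cocycle φ) (n : ℕ) :
    ((birkhoffAverage ℂ (opU α hφ) id n (memLp_logDeriv hφ).toLp : L2E) : UnitAddCircle → E)
      =ᵐ[volume] fun x => vec (meanLogDeriv α φ n x) := by
  unfold birkhoffAverage birkhoffSum
  have h1 : ∀ᵐ x, ∀ k : ℕ, ((opU α hφ)^[k] (memLp_logDeriv hφ).toLp : UnitAddCircle → E) x =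
      vec (Ad (cyc α φ k x) (logDeriv φ ((circleRotation α)^[k] x))) := by
    rw [ae_all_iff]
    intro k
    filter_upwards [coeFn_opU_iterate (α := α) hφ k (memLp_logDeriv hφ).toLp,
      ((measurePreserving_circleRotation α).iterate k).quasiMeasurePreserving.ae_eq_comp
        (MemLp.coeFn_toLp (memLp_logDeriv hφ))] with x h1 h2
    simp only [Function.comp_apply] at h2
    rw [h1, h2, unvec_vec]
  have h2 := Lp.coeFn_smul (n : ℂ)⁻¹ (∑ k ∈ Finset.range n,
    id ((opU α hφ)^[k] (memLp_logDeriv hφ).toLp))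
  have h3 := Lp.coeFn_finsetSum (Finset.range n)
    fun k => id ((opU α hφ)^[k] (memLp_logDeriv hφ).toLp)
  filter_upwards [h1, h2, h3] with x h1 h2 h3
  rw [h2, Pi.smul_apply, h3]
  have h4 : meanLogDeriv α φ n x = (n : ℂ)⁻¹ • logDeriv (cyc α φ n) x := rfl
  rw [h4, logDeriv_cyc hφ]
  rw [Finset.sum_apply]
  simp only [id, h1]
  ext ⟨i, j⟩
  simp [vec, Matrix.sum_apply]

theorem lintegral_eq (f : UnitAddCircle → E) (g : UnitAddCircle → M)
    (h : f =ᵐ[volume] fun x => vec (g x)) :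
    ∫⁻ x, ENNReal.ofReal (su2Norm (g x) ^ 2) = 2⁻¹ * eLpNorm f 2 volume ^ 2 := by
  have h0 : eLpNorm f 2 volume ^ 2 = ∫⁻ x, ‖f x‖ₑ ^ 2 := by
    have := eLpNorm_nnreal_pow_eq_lintegral (f := f) (μ := volume) (p := 2) two_ne_zero
    simpa using this
  rw [h0, ← lintegral_const_mul' _ _ (by simp)]
  refine lintegral_congr_ae ?_
  filter_upwards [h] with x hx
  rw [hx, ← ofReal_norm, ← ENNReal.ofReal_pow (norm_nonneg _), norm_vec_sq,
    ENNReal.ofReal_mul (by norm_num), ENNReal.ofReal_ofNat, ← mul_assoc,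
    ENNReal.inv_mul_cancel (by simp) (by simp), one_mul]

theorem ergodic_circleRotation (hα : Irrational α) : Ergodic (circleRotation α) volume := by
  refine AddCircle.ergodic_add_right.2 ?_
  rw [addOrderOf_eq_zero_iff]
  rw [AddCircle.not_isOfFinAddOrder_iff_forall_rat_ne_div]
  intro q hq
  exact hα ⟨q, by simpa using hq⟩

theorem exists_hasDegree (hα : Irrational α) (hφ : IsC1Cocycle φ) : ∃ d, HasDegree α φ d := by
  set V := (opU α hφ).toContinuousLinearMap
  set f₀ := (memLp_logDeriv hφ).toLp
  obtain ⟨P, hP, hconv⟩ : ∃ P : L2E, opU α hφ P = P ∧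
      Tendsto (birkhoffAverage ℂ V id · f₀) atTop (𝓝 P) :=
    ⟨_, LinearMap.mem_eqLocus.1 (SetLike.coe_mem _),
      V.tendsto_birkhoffAverage_orthogonalProjection
        (opU α hφ).norm_toContinuousLinearMap_le f₀⟩
  have hinv : (fun x => ‖(P : UnitAddCircle → E) x‖) ∘ circleRotation α =ᵐ[volume]
      fun x => ‖(P : UnitAddCircle → E) x‖ := by
    have h := coeFn_opU (α := α) hφ P
    rw [hP] at h
    filter_upwards [h] with x hx
    rw [hx, norm_act]; rfl
  obtain ⟨c, hc⟩ := (ergodic_circleRotation hα).ae_eq_const_of_ae_eq_comp_ae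
    (Lp.aestronglyMeasurable P).norm hinv
  refine ⟨(√2)⁻¹ * c, fun x => unvec ((P : UnitAddCircle → E) x), fun i j => ?_, ?_, ?_⟩
  · have h : Continuous fun v : E => unvec v i j := continuous_unvec.matrix_elem i j
    exact h.measurable.comp (Lp.stronglyMeasurable P).measurable
  · rw [Lp.tendsto_Lp_iff_tendsto_eLpNorm'] at hconv
    have h2 : Tendsto (fun n => 2⁻¹ * eLpNorm
        (((birkhoffAverage ℂ V id n f₀ : L2E) : UnitAddCircle → E) - (P : UnitAddCircle → E)) 2 volume ^ 2) atTop (𝓝 0) := by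
      have := ENNReal.Tendsto.const_mul (a := 2⁻¹) (ENNReal.Tendsto.pow (n := 2) hconv) (Or.inr (by simp))
      simpa using this
    refine h2.congr fun n => (lintegral_eq _ _ ?_).symm
    filter_upwards [coeFn_birkhoff (α := α) hφ n] with x hx
    rw [Pi.sub_apply]
    change ((birkhoffAverage ℂ (opU α hφ) id n (memLp_logDeriv hφ).toLp : L2E) : UnitAddCircle → E) x - _ = _
    rw [hx]
    conv_lhs => rw [← vec_unvec ((P : UnitAddCircle → E) x)]
    rfl
  · filter_upwards [hc] with x hx
    simp only [Function.const_apply] at hx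
    rw [← hx]
    conv_rhs => rw [← vec_unvec ((P : UnitAddCircle → E) x), norm_vec]
    rw [inv_mul_cancel_left₀ (by positivity)]

theorem measurable_vec {ψ : UnitAddCircle → M} (h : ∀ i j, Measurable fun x => ψ x i j) :
    Measurable fun x => vec (ψ x) :=
  (PiLp.continuous_toLp 2 _).measurable.comp (measurable_pi_lambda _ fun ij => h ij.1 ij.2)

theorem hasDegree_unique (hφ : IsC1Cocycle φ) {d d' : ℝ} (h : HasDegree α φ d)
    (h' : HasDegree α φ d') : d = d' := by
  obtain ⟨ψ, hm, ht, hd⟩ := h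
  obtain ⟨ψ', hm', ht', hd'⟩ := h'
  have key : ∀ A B C : M, su2Norm (B - C) ^ 2 ≤
      2 * su2Norm (A - B) ^ 2 + 2 * su2Norm (A - C) ^ 2 := fun A B C => by
    have h1 : vec (B - C) = vec (A - C) - vec (A - B) := by ext ⟨i, j⟩; simp [vec]
    have h2 := norm_sub_le (vec (A - C)) (vec (A - B))
    rw [← h1] at h2
    have h3 := norm_vec_sq (B - C)
    have h4 := norm_vec_sq (A - C)
    have h5 := norm_vec_sq (A - B)
    nlinarith [norm_nonneg (vec (B - C)), sq_nonneg (‖vec (A - C)‖ - ‖vec (A - B)‖)]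
  have hle : ∀ n, ∫⁻ x, ENNReal.ofReal (su2Norm (ψ x - ψ' x) ^ 2) ≤
      2 * (∫⁻ x, ENNReal.ofReal (su2Norm (meanLogDeriv α φ n x - ψ x) ^ 2)) +
      2 * (∫⁻ x, ENNReal.ofReal (su2Norm (meanLogDeriv α φ n x - ψ' x) ^ 2)) := fun n => by
    have hmeas : AEMeasurable
        (fun x => ENNReal.ofReal (su2Norm (meanLogDeriv α φ n x - ψ x) ^ 2)) volume := by
      have h1 : AEMeasurable (fun x => vec (meanLogDeriv α φ n x)) volume :=
        ((Lp.aestronglyMeasurable _).congr (coeFn_birkhoff (α := α) hφ n)).aemeasurable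
      have h2 := ((h1.sub (measurable_vec hm).aemeasurable).norm.pow_const 2).const_mul 2⁻¹
      refine (h2.congr (ae_of_all _ fun x => ?_)).ennreal_ofReal
      have h3 := norm_vec_sq (meanLogDeriv α φ n x - ψ x)
      have h4 : vec (meanLogDeriv α φ n x - ψ x) = vec (meanLogDeriv α φ n x) - vec (ψ x) := rfl
      rw [h4] at h3
      simp only [Pi.sub_apply]
      rw [h3]; ring
    rw [← lintegral_const_mul' _ _ (by simp), ← lintegral_const_mul' _ _ (by simp),
      ← lintegral_add_left' (hmeas.const_mul _)]
    refine lintegral_mono fun x => ?_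
    have h2 : (2 : ℝ≥0∞) = ENNReal.ofReal 2 := by simp
    rw [h2, ← ENNReal.ofReal_mul (by norm_num), ← ENNReal.ofReal_mul (by norm_num),
      ← ENNReal.ofReal_add (by positivity) (by positivity)]
    exact ENNReal.ofReal_le_ofReal (key _ _ _)
  have hlim := (ENNReal.Tendsto.const_mul (a := 2) ht (Or.inr (by simp))).add
    (ENNReal.Tendsto.const_mul (a := 2) ht' (Or.inr (by simp)))
  have hzero : ∫⁻ x, ENNReal.ofReal (su2Norm (ψ x - ψ' x) ^ 2) = 0 := by
    have := ge_of_tendsto' hlim hle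
    simpa using this
  have hmeas : Measurable fun x => ENNReal.ofReal (su2Norm (ψ x - ψ' x) ^ 2) := by
    have h2 : ∀ x, su2Norm (ψ x - ψ' x) ^ 2 = 2⁻¹ * ‖vec (ψ x) - vec (ψ' x)‖ ^ 2 := fun x => by
      have h3 := norm_vec_sq (ψ x - ψ' x)
      have h4 : vec (ψ x - ψ' x) = vec (ψ x) - vec (ψ' x) := rfl
      rw [h4] at h3
      rw [h3]; ring
    simp only [h2]
    exact ((((measurable_vec hm).sub (measurable_vec hm')).norm.pow_const 2).const_mul
      2⁻¹).ennreal_ofReal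
  rw [lintegral_eq_zero_iff hmeas] at hzero
  obtain ⟨x, h1, h2, h3⟩ := (hzero.and (hd.and hd')).exists
  have h4 : su2Norm (ψ x - ψ' x) = 0 := by
    simp only [Pi.zero_apply, ENNReal.ofReal_eq_zero] at h1
    nlinarith [su2Norm_nonneg (ψ x - ψ' x)]
  have h5 : vec (ψ x) - vec (ψ' x) = 0 := by
    have h6 := norm_vec (ψ x - ψ' x)
    rw [h4, mul_zero] at h6
    exact norm_eq_zero.1 h6
  have h6 : ψ x = ψ' x := congrArg unvec (sub_eq_zero.1 h5)
  rw [← h2, ← h3, h6]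

end DegreeExistence

theorem existsUnique_hasDegree {α : ℝ} (hα : Irrational α) {φ : UnitAddCircle → SU2}
    (hφ : IsC1Cocycle φ) : ∃! d, HasDegree α φ d := by
  obtain ⟨d, hd⟩ := DegreeExistence.exists_hasDegree hα hφ
  exact ⟨d, hd, fun d' hd' => DegreeExistence.hasDegree_unique hφ hd' hd⟩

/-- The degree of a `C¹` cocycle over an irrational rotation. -/
def cocycleDegree {α : ℝ} (hα : Irrational α) {φ : UnitAddCircle → SU2} (hφ : IsC1Cocycle φ) : ℝ :=
  (existsUnique_hasDegree hα hφ).choose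

theorem hasDegree_cocycleDegree {α : ℝ} (hα : Irrational α) {φ : UnitAddCircle → SU2}
    (hφ : IsC1Cocycle φ) : HasDegree α φ (cocycleDegree hα hφ) :=
  (existsUnique_hasDegree hα hφ).choose_spec.1

end

/-! The averages `R_n = (1/n) Dφ^(n) (φ^(n))⁻¹` are Birkhoff averages of `Dφ φ⁻¹` under the isometry
`f ↦ Ad_φ (f ∘ T)`. The mean ergodic theorem gives a limit `ψ = Ad_φ (ψ ∘ T)` with values in `su(2)`
and constant norm `d`, the degree (`exists_invariant_limit`). If `d ≠ 0`, then `ψ(x)` has the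
distinct eigenvalues `± i d`. A measurable `p` with `p ψ p⁻¹ = diag(id, -id)` makes `p φ (p ∘ T)⁻¹`
commute with that matrix, so it is diagonal (`exists_diagonalization`).

Mixing comes from oscillation: `Dφ^(n) = n R_n φ^(n)`. Take a monomial of degree `k` in the entries
of `φ^(n)` and integrate by parts against a character: the derivative of the monomial in direction
`R_n φ^(n)` has integral `O(1/n)` (`norm_integral_fourier_monomialDeriv_le`). Since `R_n → ψ` in
`L¹`, the same integrals with `ψ` in place of `R_n` tend to zero. Now `γ^(n)` is the upper left
entry of `p φ^(n) (p ∘ Tⁿ)⁻¹`, and inserting `ψ` before `φ^(n)` multiplies this entry by `i d`.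
Summing the monomials with products of entries of `p` and of `(p ∘ Tⁿ)⁻¹` as coefficients therefore
yields `k i d (γ^(n))^k` (`mixingMultipliers_pow`).

These coefficients are merely measurable, and half of them move with `n`. Hence the property carried
through is `MixingMultipliers`: `∫ a · (b ∘ Tⁿ) · g_n → 0` for all `a, b` in `L²`. It can be tested
on characters, because `e_m ∘ Tⁿ` is a unimodular constant times `e_m`.

Two diagonalizations differ by an intertwiner `q`, one of whose first row entries has constant
nonzero modulus; this entry transports the property to every admissible `γ`
(`mixingMultipliers_of_cohomologous`). On the torus the property says that the Koopman iterates of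
each character with nonzero fibre frequency tend weakly to zero. Mixing and, with the irrationality
of `α`, ergodicity follow; `a = b = 1` gives the last assertion. -/

noncomputable section

/-! ### Weak convergence on total sets -/

section Total

variable {H H' : Type*} [NormedAddCommGroup H] [InnerProductSpace ℂ H]
  [NormedAddCommGroup H'] [InnerProductSpace ℂ H']

/-- A bounded sequence of functionals that tends to zero on a total family tends to zero. -/
theorem tendsto_functional_of_total {ι : Type*} (l : ℕ → H →L[ℂ] ℂ) (C : ℝ)
    (hl : ∀ n, ‖l n‖ ≤ C) (s : ι → H)
    (hs : (Submodule.span ℂ (Set.range s)).topologicalClosure = ⊤)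
    (h : ∀ i, Tendsto (fun n => l n (s i)) atTop (𝓝 0)) (g : H) :
    Tendsto (fun n => l n g) atTop (𝓝 0) := by
  have hspan : ∀ f ∈ Submodule.span ℂ (Set.range s),
      Tendsto (fun n => l n f) atTop (𝓝 0) := fun f hf => by
    induction hf using Submodule.span_induction with
    | mem x hx => obtain ⟨i, rfl⟩ := hx; exact h i
    | zero => simp
    | add x y _ _ hx hy => simpa using hx.add hy
    | smul c x _ hx => simpa using hx.const_mul c
  have hC : 0 ≤ C := (norm_nonneg _).trans (hl 0)
  rw [Metric.tendsto_atTop]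
  intro ε hε
  have hg : g ∈ closure (Submodule.span ℂ (Set.range s) : Set H) := by
    rw [← Submodule.topologicalClosure_coe, hs]; trivial
  -- `C + 1` instead of `C` keeps the denominator positive when `C = 0`.
  obtain ⟨f, hf, hfg⟩ := Metric.mem_closure_iff.1 hg (ε / (2 * (C + 1))) (by positivity)
  obtain ⟨N, hN⟩ := Metric.tendsto_atTop.1 (hspan f hf) (ε / 2) (by positivity)
  refine ⟨N, fun n hn => ?_⟩
  have h1 := hN n hn
  rw [dist_zero_right] at h1 ⊢
  have h2 : ‖l n (g - f)‖ ≤ (C + 1) * (ε / (2 * (C + 1))) := by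
    refine ((l n).le_opNorm _).trans (mul_le_mul ((hl n).trans (by linarith)) ?_
      (norm_nonneg _) (by positivity))
    rw [← dist_eq_norm]; exact hfg.le
  have h3 : (C + 1) * (ε / (2 * (C + 1))) = ε / 2 := by field_simp
  have h4 : l n g = l n (g - f) + l n f := by simp
  calc ‖l n g‖ ≤ ‖l n (g - f)‖ + ‖l n f‖ := by rw [h4]; exact norm_add_le _ _
    _ < ε := by linarith

/-- The left vectors may move with `n`, as only their boundedness enters. Taking every `S n` to be
the identity gives a criterion for weak convergence of `v n`. -/
theorem tendsto_inner_of_total_right {ι : Type*} (v : ℕ → H) (S : ℕ → H' →L[ℂ] H) (C : ℝ)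
    (hv : ∀ n, ‖v n‖ ≤ C) (hS : ∀ n, ‖S n‖ ≤ 1) (s : ι → H')
    (hs : (Submodule.span ℂ (Set.range s)).topologicalClosure = ⊤)
    (h : ∀ i, Tendsto (fun n => inner ℂ (v n) (S n (s i))) atTop (𝓝 0)) (g : H') :
    Tendsto (fun n => inner ℂ (v n) (S n g)) atTop (𝓝 0) := by
  refine tendsto_functional_of_total (fun n => (innerSL ℂ (v n)).comp (S n)) C (fun n => ?_) s hs
    h g
  refine (ContinuousLinearMap.opNorm_comp_le _ _).trans ?_
  rw [innerSL_apply_norm]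
  exact (mul_le_of_le_one_right (norm_nonneg _) (hS n)).trans (hv n)

theorem tendsto_inner_of_total {ι : Type*} (S : ℕ → H →L[ℂ] H)
    (hS : ∀ n, ‖S n‖ ≤ 1) (s : ι → H)
    (hs : (Submodule.span ℂ (Set.range s)).topologicalClosure = ⊤)
    (h : ∀ i j, Tendsto (fun n => inner ℂ (s i) (S n (s j))) atTop (𝓝 0)) (f g : H) :
    Tendsto (fun n => inner ℂ f (S n g)) atTop (𝓝 0) := by
  have h1 : ∀ i g, Tendsto (fun n => inner ℂ (s i) (S n g)) atTop (𝓝 0) := fun i g =>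
    tendsto_inner_of_total_right (fun _ => s i) S _ (fun _ => le_rfl) hS s hs (h i) g
  -- The roles are exchanged: the images `S n g` become the moving left vectors, so that `f` can be
  -- approximated in turn.
  have h2 := tendsto_inner_of_total_right (fun n => S n g) (fun _ => .id ℂ H) ‖g‖
    (fun n => ((S n).le_opNorm g).trans (mul_le_of_le_one_left (norm_nonneg _) (hS n)))
    (fun _ => ContinuousLinearMap.norm_id_le) s hs (fun i => ?_) f
  · have := (Complex.continuous_conj.tendsto 0).comp h2
    simpa [Function.comp_def] using this
  · have := (Complex.continuous_conj.tendsto 0).comp (h1 i g)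
    simpa [Function.comp_def] using this

/-- A vector orthogonal to a total family vanishes. -/
theorem eq_zero_of_inner_total {ι : Type*} (s : ι → H)
    (hs : (Submodule.span ℂ (Set.range s)).topologicalClosure = ⊤) (g : H)
    (h : ∀ i, inner ℂ (s i) g = 0) : g = 0 := by
  have h1 := tendsto_functional_of_total (fun _ => innerSL ℂ g) _ (fun _ => le_rfl) s hs
    (fun i => by
      have : innerSL ℂ g (s i) = 0 := by
        rw [innerSL_apply_apply, ← inner_conj_symm, h i, map_zero]
      simp only [this, tendsto_const_nhds]) g
  have h2 := tendsto_nhds_unique h1 tendsto_const_nhds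
  exact inner_self_eq_zero.1 h2.symm

end Total

/-- A map with dense range sends total families to total families. -/
theorem span_toLp_closure_eq_top {X ι : Type*} [TopologicalSpace X] [CompactSpace X] [T4Space X]
    [MeasurableSpace X] [BorelSpace X] (μ : Measure X) [IsFiniteMeasure μ] [μ.WeaklyRegular]
    [SecondCountableTopologyEither X ℂ]
    (s : ι → C(X, ℂ)) (hs : (Submodule.span ℂ (Set.range s)).topologicalClosure = ⊤) :
    (Submodule.span ℂ (Set.range fun i => ContinuousMap.toLp 2 μ ℂ (s i))).topologicalClosure
      = ⊤ := by
  convert! (ContinuousMap.toLp_denseRange ℂ μ ℂ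
    (p := 2) (by simp)).topologicalClosure_map_submodule hs
  rw [Submodule.map_span, Set.range_comp' (ContinuousMap.toLp 2 μ ℂ)]
  simp only [ContinuousLinearMap.coe_coe]

/-! ### Characters of the circle and of the torus -/

theorem fourier_apply_add (m : ℤ) (x y : UnitAddCircle) :
    fourier m (x + y) = fourier m x * fourier m y := by
  simp [fourier_apply, smul_add, AddCircle.toCircle_add]

theorem norm_fourier_apply (m : ℤ) (x : UnitAddCircle) : ‖fourier m x‖ = 1 := by
  rw [fourier_apply, Circle.norm_coe]

theorem continuous_coe_circle : Continuous fun z : Circle => (z : ℂ) := continuous_subtype_val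

/-- The character `(x, z) ↦ e^{2πimx} z^k` of the torus. -/
def torusChar (i : ℤ × ℤ) : C(UnitAddCircle × Circle, ℂ) where
  toFun z := fourier i.1 z.1 * ((z.2 ^ i.2 : Circle) : ℂ)
  continuous_toFun := ((fourier i.1).continuous.comp continuous_fst).mul
    (continuous_coe_circle.comp (continuous_snd.zpow i.2))

theorem torusChar_apply (i : ℤ × ℤ) (z) :
    torusChar i z = fourier i.1 z.1 * ((z.2 ^ i.2 : Circle) : ℂ) := rfl

theorem torusChar_mul (i j : ℤ × ℤ) : torusChar i * torusChar j = torusChar (i + j) := by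
  ext z
  simp only [ContinuousMap.mul_apply, torusChar_apply, Prod.fst_add, Prod.snd_add, fourier_add,
    zpow_add, Circle.coe_mul]
  ring

theorem star_torusChar (i : ℤ × ℤ) : star (torusChar i) = torusChar (-i) := by
  ext z
  simp only [ContinuousMap.star_apply, torusChar_apply, Prod.fst_neg, Prod.snd_neg, fourier_neg,
    zpow_neg, Circle.coe_inv_eq_conj, star_mul', RCLike.star_def]

/-- The star algebra generated by the characters of the torus. -/
def torusSubalgebra : StarSubalgebra ℂ C(UnitAddCircle × Circle, ℂ) where
  toSubalgebra := Algebra.adjoin ℂ (Set.range torusChar)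
  star_mem' := by
    change Algebra.adjoin ℂ (Set.range torusChar) ≤ star (Algebra.adjoin ℂ (Set.range torusChar))
    refine Algebra.adjoin_le ?_
    rintro - ⟨i, rfl⟩
    exact Algebra.subset_adjoin ⟨-i, (star_torusChar i).symm⟩

/-- The characters are closed under multiplication, so the algebra they generate is already their
linear span. -/
theorem torusSubalgebra_coe :
    Subalgebra.toSubmodule torusSubalgebra.toSubalgebra =
      Submodule.span ℂ (Set.range torusChar) := by
  apply Algebra.adjoin_eq_span_of_subset
  refine Set.Subset.trans ?_ Submodule.subset_span
  intro x hx
  refine Submonoid.closure_induction (fun _ => id) ⟨0, ?_⟩ ?_ hx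
  · ext z; simp [torusChar_apply]
  · rintro - - - - ⟨m, rfl⟩ ⟨n, rfl⟩
    exact ⟨m + n, (torusChar_mul m n).symm⟩

theorem torusSubalgebra_separatesPoints : torusSubalgebra.SeparatesPoints := by
  intro x y hxy
  by_cases h1 : x.1 = y.1
  · have h2 : x.2 ≠ y.2 := fun h2 => hxy (Prod.ext h1 h2)
    refine ⟨_, ⟨torusChar (0, 1), Algebra.subset_adjoin ⟨(0, 1), rfl⟩, rfl⟩, ?_⟩
    simpa [torusChar_apply, Circle.coe_inj] using h2
  · refine ⟨_, ⟨torusChar (1, 0), Algebra.subset_adjoin ⟨(1, 0), rfl⟩, rfl⟩, ?_⟩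
    simp only [torusChar_apply, fourier_one, zpow_zero, Circle.coe_one, mul_one]
    contrapose h1
    rw [Circle.coe_inj] at h1
    exact AddCircle.injective_toCircle one_ne_zero h1

theorem span_torusChar_closure_eq_top :
    (Submodule.span ℂ (Set.range torusChar)).topologicalClosure = ⊤ := by
  rw [← torusSubalgebra_coe]
  exact congr_arg (Subalgebra.toSubmodule <| StarSubalgebra.toSubalgebra ·)
    (ContinuousMap.starSubalgebra_topologicalClosure_eq_top_of_separatesPoints torusSubalgebra
      torusSubalgebra_separatesPoints)

instance : IsProbabilityMeasure torusMeasure := by unfold torusMeasure; infer_instance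

instance : SecondCountableTopology Circle :=
  Topology.IsEmbedding.subtypeVal.secondCountableTopology

/-- The characters of the torus in `L²`. -/
def torusCharLp (i : ℤ × ℤ) : Lp ℂ 2 torusMeasure := ContinuousMap.toLp 2 torusMeasure ℂ (torusChar i)

theorem span_torusCharLp_closure_eq_top :
    (Submodule.span ℂ (Set.range torusCharLp)).topologicalClosure = ⊤ :=
  span_toLp_closure_eq_top torusMeasure torusChar span_torusChar_closure_eq_top

/-- The characters of the circle in `L²`. -/
def circleCharLp (m : ℤ) : Lp ℂ 2 (volume : Measure UnitAddCircle) :=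
  ContinuousMap.toLp 2 volume ℂ (fourier m)

theorem span_circleCharLp_closure_eq_top :
    (Submodule.span ℂ (Set.range circleCharLp)).topologicalClosure = ⊤ :=
  span_toLp_closure_eq_top volume fourier span_fourier_closure_eq_top

/-! ### Weak mixing of a sequence of multipliers -/

/-- The functions `g n`, viewed as multipliers, are mixing along the rotation by `α`:
the integrals of `a(x) b(Tⁿ x) g_n(x)` tend to zero for all `a`, `b` in `L²`. -/
def MixingMultipliers (α : ℝ) (g : ℕ → UnitAddCircle → ℂ) : Prop :=
  ∀ a b : UnitAddCircle → ℂ, MemLp a 2 volume → MemLp b 2 volume →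
    Tendsto (fun n => ∫ x, a x * b ((circleRotation α)^[n] x) * g n x) atTop (𝓝 0)

theorem MixingMultipliers.conj {α : ℝ} {g : ℕ → UnitAddCircle → ℂ} (h : MixingMultipliers α g) :
    MixingMultipliers α fun n x => conj (g n x) := by
  intro a b ha hb
  have h1 := h (star a) (star b) ha.star hb.star
  have := (Complex.continuous_conj.tendsto 0).comp h1
  rw [map_zero] at this
  refine this.congr fun n => ?_
  rw [Function.comp_apply, ← integral_conj]
  simp

/-- It suffices to test against characters. -/
theorem mixingMultipliers_of_fourier {α : ℝ} {g : ℕ → UnitAddCircle → ℂ} {C : ℝ}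
    (hm : ∀ n, AEStronglyMeasurable (g n) volume) (hC : ∀ n, ∀ᵐ x, ‖g n x‖ ≤ C)
    (h : ∀ m, Tendsto (fun n => ∫ x, fourier m x * g n x) atTop (𝓝 0)) :
    MixingMultipliers α g := by
  have hmp := fun n => (measurePreserving_circleRotation α).iterate n
  have hC0 : 0 ≤ C := by
    obtain ⟨x, hx⟩ := (hC 0).exists
    exact (norm_nonneg _).trans hx
  -- The conjugate offsets the conjugation in the first argument of the inner product.
  have hv : ∀ (a : UnitAddCircle → ℂ), MemLp a 2 volume → ∀ n, MemLp (fun x => conj (a x * g n x)) 2 volume ∧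
      eLpNorm (fun x => conj (a x * g n x)) 2 volume ≤ ENNReal.ofReal C * eLpNorm a 2 volume := by
    intro a ha n
    have h1 : AEStronglyMeasurable (fun x => conj (a x * g n x)) volume :=
      Complex.continuous_conj.comp_aestronglyMeasurable (ha.1.mul (hm n))
    have h2 : ∀ᵐ x, ‖conj (a x * g n x)‖ ≤ C * ‖a x‖ := by
      filter_upwards [hC n] with x hx
      rw [RCLike.norm_conj, norm_mul, mul_comm]
      exact mul_le_mul_of_nonneg_right hx (norm_nonneg _)
    exact ⟨ha.of_le_mul h1 h2, eLpNorm_le_mul_eLpNorm_of_ae_le_mul h2 2⟩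
  have key : ∀ (a b : UnitAddCircle → ℂ) (ha : MemLp a 2 volume) (hb : MemLp b 2 volume) n,
      inner ℂ (hv a ha n).1.toLp ((koopman (hmp n)) hb.toLp) =
        ∫ x, a x * b ((circleRotation α)^[n] x) * g n x := by
    intro a b ha hb n
    rw [L2.inner_def]
    refine integral_congr_ae ?_
    have h1 : koopman (hmp n) hb.toLp = (hb.comp_measurePreserving (hmp n)).toLp := by
      exact Lp.toLp_compMeasurePreserving _ _
    filter_upwards [(hv a ha n).1.coeFn_toLp, (hb.comp_measurePreserving (hmp n)).coeFn_toLp]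
      with x h2 h3
    rw [h1, h2, h3]
    simp
    ring
  have hbd : ∀ (a : UnitAddCircle → ℂ) (ha : MemLp a 2 volume) n, ‖(hv a ha n).1.toLp‖ ≤
      C * (eLpNorm a 2 volume).toReal := by
    intro a ha n
    rw [Lp.norm_toLp, ← ENNReal.toReal_ofReal hC0, ← ENNReal.toReal_mul]
    exact ENNReal.toReal_mono (ENNReal.mul_ne_top (by simp) ha.2.ne) (hv a ha n).2
  have hf : ∀ m : ℤ, MemLp (fourier m : UnitAddCircle → ℂ) 2 volume := fun m =>
    (fourier m).continuous.memLp_of_hasCompactSupport (HasCompactSupport.of_compactSpace _)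
  have hft : ∀ m, circleCharLp m = (hf m).toLp := fun m => by
    refine Lp.ext ?_
    filter_upwards [ContinuousMap.coeFn_toLp (p := 2) (𝕜 := ℂ) volume (fourier m : C(UnitAddCircle, ℂ)),
      (hf m).coeFn_toLp] with x h1 h2
    rw [h2]; exact h1
  -- For fixed `a`, density in `b` reduces to `b = e_m`, where `e_m ∘ Tⁿ` is `e_m` up to a phase
  -- depending on `n`; norms do not see the phase. Afterwards density in `a` applies, and `e_m e_j =
  -- e_{m+j}`.
  have step : ∀ (a : UnitAddCircle → ℂ), MemLp a 2 volume →
      (∀ m, Tendsto (fun n => ∫ x, a x * fourier m x * g n x) atTop (𝓝 0)) →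
      ∀ b : UnitAddCircle → ℂ, MemLp b 2 volume →
        Tendsto (fun n => ∫ x, a x * b ((circleRotation α)^[n] x) * g n x) atTop (𝓝 0) := by
    intro a ha h1 b hb
    have h2 := tendsto_inner_of_total_right (fun n => (hv a ha n).1.toLp)
      (fun n => (koopman (hmp n)).toContinuousLinearMap) _ (hbd a ha)
      (fun n => LinearIsometry.norm_toContinuousLinearMap_le _) circleCharLp
      span_circleCharLp_closure_eq_top (fun m => ?_) hb.toLp
    · exact h2.congr fun n => key a b ha hb n
    · simp only [hft]
      refine Tendsto.congr (fun n => (key a _ ha (hf m) n).symm) ?_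
      rw [tendsto_zero_iff_norm_tendsto_zero]
      refine (tendsto_zero_iff_norm_tendsto_zero.1 (h1 m)).congr fun n => ?_
      have h3 : ∀ x, a x * fourier m ((circleRotation α)^[n] x) * g n x =
          fourier m (n • (α : UnitAddCircle)) * (a x * fourier m x * g n x) := fun x => by
        rw [DegreeExistence.circleRotation_iterate, fourier_apply_add]; ring
      simp only [h3]
      rw [integral_const_mul, norm_mul, norm_fourier_apply, one_mul]
  intro a b ha hb
  refine step a ha (fun m => ?_) b hb
  have h1 := tendsto_inner_of_total_right (fun n => (hv _ (hf m) n).1.toLp)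
      (fun n => ContinuousLinearMap.id ℂ _) _ (hbd _ (hf m))
      (fun n => ContinuousLinearMap.norm_id_le) circleCharLp
      span_circleCharLp_closure_eq_top (fun j => ?_) ha.toLp
  · refine h1.congr fun n => ?_
    rw [ContinuousLinearMap.id_apply, L2.inner_def]
    refine integral_congr_ae ?_
    filter_upwards [(hv _ (hf m) n).1.coeFn_toLp, ha.coeFn_toLp] with x h2 h3
    rw [h2, h3]
    simp
    ring
  · simp only [hft]
    refine (h (m + j)).congr fun n => ?_
    rw [ContinuousLinearMap.id_apply, L2.inner_def]
    refine integral_congr_ae ?_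
    filter_upwards [(hv _ (hf m) n).1.coeFn_toLp, (hf j).coeFn_toLp] with x h2 h3
    rw [h2, h3, fourier_add]
    simp
    ring

open DegreeExistence

/-! ### The Lie algebra `su(2)` and matrices in `SU(2)` -/

/-- The adjugate of a unitary matrix of determinant one is its inverse, hence its adjoint. -/
theorem SU2_entries (u : SU2) : u.1 1 1 = conj (u.1 0 0) ∧ u.1 1 0 = -conj (u.1 0 1) := by
  have hdet : u.1.det = 1 := (Matrix.mem_specialUnitaryGroup_iff.1 u.2).2
  have h1 : u.1.adjugate = star u.1 := by
    have h2 : u.1 * u.1.adjugate = 1 := by rw [Matrix.mul_adjugate, hdet, one_smul]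
    have h3 : star u.1 * u.1 = 1 := inv_mul_coe u
    calc u.1.adjugate = (star u.1 * u.1) * u.1.adjugate := by rw [h3, one_mul]
      _ = star u.1 := by rw [mul_assoc, h2, mul_one]
  rw [Matrix.adjugate_fin_two] at h1
  have h4 := congrFun (congrFun h1 0) 0
  have h5 := congrFun (congrFun h1 1) 0
  simp [Matrix.star_apply] at h4 h5
  exact ⟨h4, by rw [← h5, neg_neg]⟩

theorem SU2_unit (u : SU2) :
    u.1 0 0 * conj (u.1 0 0) + u.1 0 1 * conj (u.1 0 1) = 1 := by
  have h := congrFun (congrFun (mul_inv_coe u) 0) 0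
  simpa [coe_inv, Matrix.mul_apply, Matrix.star_apply] using h

/-- The matrix with first row `(a, b)` in `SU(2)`. -/
def SU2.mk (a b : ℂ) (h : a * conj a + b * conj b = 1) : SU2 :=
  ⟨!![a, b; -conj b, conj a], by
    rw [Matrix.mem_specialUnitaryGroup_iff, Matrix.mem_unitaryGroup_iff]
    refine ⟨?_, by simpa [Matrix.det_fin_two] using h⟩
    ext i j
    fin_cases i <;> fin_cases j <;>
      simp [Matrix.mul_apply, Fin.sum_univ_two, Matrix.star_apply]
    · exact h
    · ring
    · ring
    · linear_combination h⟩

/-- The Lie algebra `su(2)`, as a set of matrices. -/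
def su2Set : Set M :=
  {A | conj (A 0 0) = -A 0 0 ∧ A 1 1 = conj (A 0 0) ∧ A 1 0 = -conj (A 0 1)}

theorem isClosed_unvec_su2Set : IsClosed {v : E | unvec v ∈ su2Set} := by
  have h : ∀ i j, Continuous fun v : E => unvec v i j := fun i j => continuous_unvec.matrix_elem i j
  have hc : ∀ i j, Continuous fun v : E => conj (unvec v i j) := fun i j =>
    Complex.continuous_conj.comp (h i j)
  exact (isClosed_eq (hc _ _) (h _ _).neg).inter
    ((isClosed_eq (h _ _) (hc _ _)).inter (isClosed_eq (h _ _) (hc _ _).neg))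

/-- Differentiating the relations between the entries of an element of `SU(2)` gives the relations
of the Lie algebra; the unit length of the first row makes the upper left entry imaginary. -/
theorem logDeriv_mem_su2Set {χ : UnitAddCircle → SU2} (hχ : Diff fun x => (χ x).1)
    (x : UnitAddCircle) : logDeriv χ x ∈ su2Set := by
  have hconj : ∀ {f : ℝ → ℂ} {f' : ℂ}, HasDerivAt f f' 0 →
      HasDerivAt (fun t => conj (f t)) (conj f') 0 := fun h => h.star
  set F := fun y => (χ y).1
  have hd := fun i j => hasDeriv hχ x i j
  have e11 : circleDeriv F x 1 1 = conj (circleDeriv F x 0 0) := by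
    refine (hd 1 1).unique ((hconj (hd 0 0)).congr_of_eventuallyEq (Eventually.of_forall fun t => ?_))
    exact (SU2_entries _).1
  have e10 : circleDeriv F x 1 0 = -conj (circleDeriv F x 0 1) := by
    refine (hd 1 0).unique
      ((hconj (hd 0 1)).neg.congr_of_eventuallyEq (Eventually.of_forall fun t => ?_))
    exact (SU2_entries _).2
  have e0 := (((hd 0 0).mul (hconj (hd 0 0))).add ((hd 0 1).mul (hconj (hd 0 1)))).unique
    ((hasDerivAt_const (0 : ℝ) (1 : ℂ)).congr_of_eventuallyEq
      (Eventually.of_forall fun t => SU2_unit _))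
  simp only [AddCircle.coe_zero, add_zero] at e0
  obtain ⟨f11, f10⟩ := SU2_entries (χ x)
  have hF : ∀ i j, F x i j = (χ x).1 i j := fun _ _ => rfl
  simp only [hF] at e0
  refine ⟨?_, ?_, ?_⟩ <;>
  · simp only [DegreeExistence.logDeriv, coe_inv, Matrix.mul_apply, Fin.sum_univ_two, Matrix.star_apply, f11, f10,
      RCLike.star_def]
    simp only [show (fun y => (χ y).1) = F from rfl, e11, e10]
    simp only [map_add, map_mul, map_neg, Complex.conj_conj]
    first | linear_combination e0 | ring

theorem meanLogDeriv_mem_su2Set {α : ℝ} {φ : UnitAddCircle → SU2} (hφ : IsC1Cocycle φ) (n : ℕ)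
    (x : UnitAddCircle) : meanLogDeriv α φ n x ∈ su2Set := by
  have h4 : meanLogDeriv α φ n x = (n : ℂ)⁻¹ • logDeriv (cyc α φ n) x := rfl
  obtain ⟨h1, h2, h3⟩ := logDeriv_mem_su2Set (diff_cyc (α := α) hφ n) x
  rw [h4]
  refine ⟨?_, ?_, ?_⟩ <;>
    simp [h1, h2, h3]

/-- The limit of the functions `(1/n) Dφ^(n) (φ^(n))⁻¹` is invariant, has values in `su(2)`, and
its norm is the degree. -/
theorem exists_invariant_limit {α : ℝ} {φ : UnitAddCircle → SU2} (hα : Irrational α)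
    (hφ : IsC1Cocycle φ) :
    ∃ ψ : UnitAddCircle → M, (∀ i j, Measurable fun x => ψ x i j) ∧
      Tendsto (fun n : ℕ => ∫⁻ x, ENNReal.ofReal (su2Norm (meanLogDeriv α φ n x - ψ x) ^ 2))
        atTop (𝓝 0) ∧
      (∀ᵐ x, su2Norm (ψ x) = cocycleDegree hα hφ) ∧
      (∀ᵐ x, ψ x = Ad (φ x) (ψ (circleRotation α x))) ∧ ∀ᵐ x, ψ x ∈ su2Set := by
  set V := (opU α hφ).toContinuousLinearMap
  set f₀ := (memLp_logDeriv hφ).toLp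
  obtain ⟨P, hP, hconv⟩ : ∃ P : L2E, opU α hφ P = P ∧
      Tendsto (birkhoffAverage ℂ V id · f₀) atTop (𝓝 P) :=
    ⟨_, LinearMap.mem_eqLocus.1 (SetLike.coe_mem _),
      V.tendsto_birkhoffAverage_orthogonalProjection
        (opU α hφ).norm_toContinuousLinearMap_le f₀⟩
  have hPx : ∀ᵐ x, (P : UnitAddCircle → E) x =
      vec (Ad (φ x) (unvec ((P : UnitAddCircle → E) (circleRotation α x)))) := by
    have h := coeFn_opU (α := α) hφ P
    rwa [hP] at h
  have hinv : (fun x => ‖(P : UnitAddCircle → E) x‖) ∘ circleRotation α =ᵐ[volume]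
      fun x => ‖(P : UnitAddCircle → E) x‖ := by
    filter_upwards [hPx] with x hx
    rw [hx, norm_act]; rfl
  obtain ⟨c, hc⟩ := (ergodic_circleRotation hα).ae_eq_const_of_ae_eq_comp_ae
    (Lp.aestronglyMeasurable P).norm hinv
  have hm : ∀ i j, Measurable fun x => unvec ((P : UnitAddCircle → E) x) i j := fun i j => by
    have h : Continuous fun v : E => unvec v i j := continuous_unvec.matrix_elem i j
    exact h.measurable.comp (Lp.stronglyMeasurable P).measurable
  have ht : Tendsto (fun n : ℕ => ∫⁻ x, ENNReal.ofReal
      (su2Norm (meanLogDeriv α φ n x - unvec ((P : UnitAddCircle → E) x)) ^ 2))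
      atTop (𝓝 0) := by
    have hconv' := hconv
    rw [Lp.tendsto_Lp_iff_tendsto_eLpNorm'] at hconv'
    have h2 : Tendsto (fun n => 2⁻¹ * eLpNorm
        (((birkhoffAverage ℂ V id n f₀ : L2E) : UnitAddCircle → E) - (P : UnitAddCircle → E))
          2 volume ^ 2) atTop (𝓝 0) := by
      have := ENNReal.Tendsto.const_mul (a := 2⁻¹) (ENNReal.Tendsto.pow (n := 2) hconv')
        (Or.inr (by simp))
      simpa using this
    refine h2.congr fun n => (lintegral_eq _ _ ?_).symm
    filter_upwards [coeFn_birkhoff (α := α) hφ n] with x hx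
    rw [Pi.sub_apply]
    change ((birkhoffAverage ℂ (opU α hφ) id n (memLp_logDeriv hφ).toLp : L2E) :
      UnitAddCircle → E) x - _ = _
    rw [hx]
    conv_lhs => rw [← vec_unvec ((P : UnitAddCircle → E) x)]
    rfl
  have hnorm : ∀ᵐ x, su2Norm (unvec ((P : UnitAddCircle → E) x)) = (√2)⁻¹ * c := by
    filter_upwards [hc] with x hx
    simp only [Function.const_apply] at hx
    rw [← hx]
    conv_rhs => rw [← vec_unvec ((P : UnitAddCircle → E) x), norm_vec]
    rw [inv_mul_cancel_left₀ (by positivity)]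
  -- The degree was chosen abstractly; uniqueness identifies it with the norm of this limit.
  have hdeg := hasDegree_unique hφ ⟨_, hm, ht, hnorm⟩ (hasDegree_cocycleDegree hα hφ)
  refine ⟨_, hm, ht, hdeg ▸ hnorm, ?_, ?_⟩
  · filter_upwards [hPx] with x hx
    exact congrArg unvec hx
  -- A subsequence converges almost everywhere, and `su(2)` is closed.
  · obtain ⟨ns, -, hns⟩ := (tendstoInMeasure_of_tendsto_Lp hconv).exists_seq_tendsto_ae
    have h1 : ∀ᵐ x, ∀ n, ((birkhoffAverage ℂ V id n f₀ : L2E) : UnitAddCircle → E) x =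
        vec (meanLogDeriv α φ n x) := ae_all_iff.2 fun n => coeFn_birkhoff (α := α) hφ n
    filter_upwards [hns, h1] with x h2 h3
    refine isClosed_unvec_su2Set.mem_of_tendsto h2 (Eventually.of_forall fun i => ?_)
    rw [h3]
    exact meanLogDeriv_mem_su2Set hφ _ x

/-! ### Diagonalization -/

/-- The vector `(a, b)`, normalized; `(0, 1)` if it is zero. -/
def unitRow (a b : ℂ) : ℂ × ℂ :=
  if ‖a‖ ^ 2 + ‖b‖ ^ 2 = 0 then (0, 1) else
    (a / (√(‖a‖ ^ 2 + ‖b‖ ^ 2) : ℝ), b / (√(‖a‖ ^ 2 + ‖b‖ ^ 2) : ℝ))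

theorem unitRow_unit (a b : ℂ) : (unitRow a b).1 * conj (unitRow a b).1 +
    (unitRow a b).2 * conj (unitRow a b).2 = 1 := by
  unfold unitRow
  split_ifs with h
  · simp
  · have h1 : (√(‖a‖ ^ 2 + ‖b‖ ^ 2) : ℝ) ≠ 0 := by
      rw [Real.sqrt_ne_zero (by positivity)]; exact h
    have h2 : (((√(‖a‖ ^ 2 + ‖b‖ ^ 2) : ℝ)) : ℂ) ^ 2 = a * conj a + b * conj b := by
      rw [← Complex.ofReal_pow, Real.sq_sqrt (by positivity), Complex.mul_conj, Complex.mul_conj,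
        Complex.normSq_eq_norm_sq, Complex.normSq_eq_norm_sq]
      push_cast; rfl
    have h3 : (((√(‖a‖ ^ 2 + ‖b‖ ^ 2) : ℝ)) : ℂ) ≠ 0 := by exact_mod_cast h1
    simp only [map_div₀, Complex.conj_ofReal]
    field_simp
    exact h2.symm

/-- The matrix in `SU(2)` whose first row is a left eigenvector of `A` for the eigenvalue `i d`,
if `A` is in `su(2)` and has norm `d`. -/
def diagonalizer (d : ℝ) (A : M) : SU2 :=
  SU2.mk _ _ (unitRow_unit (A 0 0 + Complex.I * d) (A 0 1))

theorem measurable_diagonalizer (d : ℝ) {ψ : UnitAddCircle → M}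
    (hψ : ∀ i j, Measurable fun x => ψ x i j) (i j : Fin 2) :
    Measurable fun x => (diagonalizer d (ψ x)).1 i j := by
  have ha : Measurable fun x => ψ x 0 0 + Complex.I * d := (hψ 0 0).add_const _
  have hs : MeasurableSet {x | ‖ψ x 0 0 + Complex.I * d‖ ^ 2 + ‖ψ x 0 1‖ ^ 2 = 0} :=
    measurableSet_eq_fun ((ha.norm.pow_const 2).add ((hψ 0 1).norm.pow_const 2)) measurable_const
  have hq : Measurable fun x =>
      ((√(‖ψ x 0 0 + Complex.I * d‖ ^ 2 + ‖ψ x 0 1‖ ^ 2) : ℝ) : ℂ) :=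
    Complex.measurable_ofReal.comp ((ha.norm.pow_const 2).add ((hψ 0 1).norm.pow_const 2)).sqrt
  have hu : Measurable fun x => unitRow (ψ x 0 0 + Complex.I * d) (ψ x 0 1) :=
    Measurable.ite hs measurable_const ((ha.div hq).prodMk ((hψ 0 1).div hq))
  have hc := Complex.continuous_conj.measurable
  fin_cases i <;> fin_cases j
  · exact hu.fst
  · exact hu.snd
  · exact (hc.comp hu.snd).neg
  · exact hc.comp hu.fst

/-- The diagonal matrix with entries `i d` and `- i d`. -/
def diagLie (d : ℝ) : M := !![Complex.I * d, 0; 0, -(Complex.I * d)]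

/-- For such `A` one has `A² = -d²`, so `(A + id) A = id (A + id)`: the rows of `A + id` are left
eigenvectors for `id`. If the first row vanishes, then `A = diag(-id, id)` and the default `(0, 1)`
is an eigenvector. The second row of the diagonalizer follows by conjugation. -/
theorem diagonalizer_mul {d : ℝ} {A : M} (hA : A ∈ su2Set) (hd : su2Norm A = d) :
    (diagonalizer d A).1 * A = diagLie d * (diagonalizer d A).1 := by
  obtain ⟨h1, h2, h3⟩ := hA
  -- This is `det A = d²`.
  have hn : -(A 0 0) ^ 2 + A 0 1 * conj (A 0 1) = (d : ℂ) ^ 2 := by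
    have h4 : su2Norm A ^ 2 = ‖A 0 0‖ ^ 2 + ‖A 0 1‖ ^ 2 := by
      rw [su2Norm, Real.sq_sqrt (by positivity)]
      simp only [Fin.sum_univ_two, h2, h3, norm_neg, RCLike.norm_conj]
      ring
    rw [hd] at h4
    rw [← Complex.ofReal_pow, h4, Complex.mul_conj, Complex.normSq_eq_norm_sq]
    have h5 := Complex.mul_conj (A 0 0)
    rw [h1, Complex.normSq_eq_norm_sq] at h5
    push_cast at h5 ⊢
    linear_combination h5
  set u := unitRow (A 0 0 + Complex.I * d) (A 0 1) with hu
  have hI := Complex.I_sq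
  have e1 : u.1 * A 0 0 - u.2 * conj (A 0 1) = Complex.I * d * u.1 := by
    rw [hu]; unfold unitRow
    split_ifs with h
    · have : A 0 1 = 0 := by
        have : ‖A 0 1‖ ^ 2 = 0 := by nlinarith [sq_nonneg ‖A 0 0 + Complex.I * d‖, sq_nonneg ‖A 0 1‖]
        simpa using this
      simp [this]
    · rw [div_mul_eq_mul_div, div_mul_eq_mul_div, ← sub_div, mul_div_assoc']
      congr 1
      linear_combination (-1 : ℂ) * hn - (d : ℂ) ^ 2 * hI
  have e2 : u.1 * A 0 1 - u.2 * A 0 0 = Complex.I * d * u.2 := by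
    rw [hu]; unfold unitRow
    split_ifs with h
    · have : A 0 0 + Complex.I * d = 0 := by
        have : ‖A 0 0 + Complex.I * d‖ ^ 2 = 0 := by
          nlinarith [sq_nonneg ‖A 0 0 + Complex.I * d‖, sq_nonneg ‖A 0 1‖]
        simpa using this
      simp only; linear_combination -this
    · rw [div_mul_eq_mul_div, div_mul_eq_mul_div, ← sub_div, mul_div_assoc']
      congr 1
      ring
  have e1' := congrArg conj e1
  have e2' := congrArg conj e2
  simp only [map_sub, map_mul, h1, Complex.conj_conj, Complex.conj_I, Complex.conj_ofReal]
    at e1' e2'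
  have hp : (diagonalizer d A).1 = !![u.1, u.2; -conj u.2, conj u.1] := rfl
  rw [hp]
  ext i j
  fin_cases i <;> fin_cases j <;>
    simp [diagLie, Matrix.mul_apply, Fin.sum_univ_two, h1, h2, h3]
  · linear_combination e1
  · linear_combination e2
  · linear_combination -e2'
  · linear_combination e1'

/-- The eigenvalues `± id` are distinct, so the commutant consists of diagonal matrices. Writing the
entry through its argument gives an element of the circle that depends measurably on `u`. -/
theorem eq_diagSU2_of_commute {d : ℝ} (hd : d ≠ 0) {u : SU2}
    (h : u.1 * diagLie d = diagLie d * u.1) : u = diagSU2 (Circle.exp (u.1 0 0).arg) := by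
  have h1 : u.1 0 1 = 0 := by
    have h2 := congrFun (congrFun h 0) 1
    simp [diagLie, Matrix.mul_apply, Fin.sum_univ_two] at h2
    have h3 : u.1 0 1 * (2 * (Complex.I * d)) = 0 := by linear_combination -h2
    have h4 : (2 * (Complex.I * d) : ℂ) ≠ 0 := by simp [hd]
    exact (mul_eq_zero.1 h3).resolve_right h4
  obtain ⟨f11, f10⟩ := SU2_entries u
  have h5 := SU2_unit u
  rw [h1, zero_mul, add_zero, Complex.mul_conj, Complex.normSq_eq_norm_sq] at h5
  have h6 : ‖u.1 0 0‖ = 1 := by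
    have : ‖u.1 0 0‖ ^ 2 = 1 := by exact_mod_cast h5
    exact (pow_eq_one_iff_of_nonneg (norm_nonneg _) two_ne_zero).1 this
  have h7 : ((Circle.exp (u.1 0 0).arg : Circle) : ℂ) = u.1 0 0 := by
    have := Complex.norm_mul_exp_arg_mul_I (u.1 0 0)
    rw [h6] at this
    simpa [Circle.coe_exp] using this
  refine Subtype.ext ?_
  have h8 : (diagSU2 (Circle.exp (u.1 0 0).arg)).1 = !![u.1 0 0, 0; 0, conj (u.1 0 0)] := by
    simp only [diagSU2, h7]
  rw [h8]
  ext i j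
  fin_cases i <;> fin_cases j <;> simp [h1, f11, f10]

theorem diagSU2_mul (z w : Circle) : diagSU2 (z * w) = diagSU2 z * diagSU2 w := by
  refine Subtype.ext ?_
  change (diagSU2 (z * w)).1 = (diagSU2 z).1 * (diagSU2 w).1
  ext i j
  fin_cases i <;> fin_cases j <;> simp [diagSU2, Matrix.mul_apply, Fin.sum_univ_two]

theorem diagSU2_one : diagSU2 1 = 1 := by
  refine Subtype.ext ?_
  change _ = (1 : M)
  ext i j
  fin_cases i <;> fin_cases j <;> simp [diagSU2]

/-- Entries of a product in `SU(2)`. -/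
theorem SU2_mul_apply (u v : SU2) (i j : Fin 2) :
    (u * v).1 i j = u.1 i 0 * v.1 0 j + u.1 i 1 * v.1 1 j := by
  change (u.1 * v.1) i j = _
  simp [Matrix.mul_apply, Fin.sum_univ_two]

theorem SU2_inv_apply (u : SU2) (i j : Fin 2) : (u⁻¹).1 i j = conj (u.1 j i) := by
  rw [coe_inv, Matrix.star_apply]; rfl

theorem measurable_mul_entries {u v : UnitAddCircle → SU2}
    (hu : ∀ i j, Measurable fun x => (u x).1 i j) (hv : ∀ i j, Measurable fun x => (v x).1 i j)
    (i j : Fin 2) : Measurable fun x => (u x * v x).1 i j := by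
  simp only [SU2_mul_apply]
  exact ((hu _ _).mul (hv _ _)).add ((hu _ _).mul (hv _ _))

theorem measurable_inv_entries {u : UnitAddCircle → SU2}
    (hu : ∀ i j, Measurable fun x => (u x).1 i j)
    (i j : Fin 2) : Measurable fun x => ((u x)⁻¹).1 i j := by
  simp only [SU2_inv_apply]
  exact Complex.continuous_conj.measurable.comp (hu _ _)

theorem cocycleIter_of_cohomologous {G : Type*} [Group G] {α : ℝ} {φ δ p : UnitAddCircle → G}
    (h : ∀ᵐ x, φ x = (p x)⁻¹ * δ x * p (circleRotation α x)) :
    ∀ᵐ x, ∀ n, cocycleIter (circleRotation α) φ n x =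
      (p x)⁻¹ * cocycleIter (circleRotation α) δ n x * p ((circleRotation α)^[n] x) := by
  have h1 : ∀ᵐ x, ∀ n : ℕ, φ ((circleRotation α)^[n] x) = (p ((circleRotation α)^[n] x))⁻¹ *
      δ ((circleRotation α)^[n] x) * p (circleRotation α ((circleRotation α)^[n] x)) :=
    ae_all_iff.2 fun n => by
      have h' := ((measurePreserving_circleRotation α).iterate n).quasiMeasurePreserving.ae h
      exact h'
  filter_upwards [h1] with x hx n
  induction n with
  | zero => simp [cocycleIter]
  | succ n ih =>
    rw [cocycleIter, cocycleIter, ih, hx n, Function.iterate_succ_apply']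
    group

theorem cocycleIter_diagSU2 (T : UnitAddCircle → UnitAddCircle) (γ : UnitAddCircle → Circle)
    (n : ℕ) (x : UnitAddCircle) :
    cocycleIter T (fun x => diagSU2 (γ x)) n x = diagSU2 (cocycleIter T γ n x) := by
  induction n with
  | zero => simp [cocycleIter, diagSU2_one]
  | succ n ih => rw [cocycleIter, cocycleIter, ih, diagSU2_mul]

/-- The cocycle is conjugate to a diagonal one by a measurable function that diagonalizes the
limit of the logarithmic derivatives. -/
theorem exists_diagonalization {α : ℝ} {φ : UnitAddCircle → SU2} {d : ℝ} (hd : d ≠ 0)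
    {ψ : UnitAddCircle → M} (hm : ∀ i j, Measurable fun x => ψ x i j)
    (hφ : ∀ i j, Measurable fun x => (φ x).1 i j)
    (hn : ∀ᵐ x, su2Norm (ψ x) = d) (hinv : ∀ᵐ x, ψ x = Ad (φ x) (ψ (circleRotation α x)))
    (hs : ∀ᵐ x, ψ x ∈ su2Set) :
    ∃ (p : UnitAddCircle → SU2) (γ : UnitAddCircle → Circle),
      (∀ i j, Measurable fun x => (p x).1 i j) ∧ Measurable γ ∧
      (∀ᵐ x, φ x = (p x)⁻¹ * diagSU2 (γ x) * p (circleRotation α x)) ∧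
      ∀ᵐ x, (p x).1 * ψ x = diagLie d * (p x).1 := by
  set p : UnitAddCircle → SU2 := fun x => diagonalizer d (ψ x)
  have hpm : ∀ i j, Measurable fun x => (p x).1 i j := measurable_diagonalizer d hm
  have hp : ∀ᵐ x, (p x).1 * ψ x = diagLie d * (p x).1 := by
    filter_upwards [hn, hs] with x h1 h2
    exact diagonalizer_mul h2 h1
  have hrot := (measurePreserving_circleRotation α).measurable
  set δ : UnitAddCircle → SU2 := fun x => p x * φ x * (p (circleRotation α x))⁻¹ with hδ
  have hδm : ∀ i j, Measurable fun x => (δ x).1 i j :=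
    measurable_mul_entries (measurable_mul_entries hpm hφ)
      (measurable_inv_entries fun i j => (hpm i j).comp hrot)
  refine ⟨p, fun x => Circle.exp ((δ x).1 0 0).arg, hpm,
    Circle.exp.continuous.measurable.comp (Complex.measurable_arg.comp (hδm 0 0)), ?_, hp⟩
  filter_upwards [hp, (measurePreserving_circleRotation α).quasiMeasurePreserving.ae hp, hinv]
    with x h1 h2 h3
  -- `p` carries `ψ` to the constant matrix `diagLie d` at `x` and at `T x`, and `φ` carries `ψ (T
  -- x)` to `ψ x`; hence `δ x` commutes with `diagLie d`.
  have h4 : δ x = diagSU2 (Circle.exp ((δ x).1 0 0).arg) := by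
    refine eq_diagSU2_of_commute hd ?_
    set q := p (circleRotation α x)
    set ψ' := ψ (circleRotation α x)
    have h5 : (δ x).1 = (p x).1 * (φ x).1 * (q⁻¹ : SU2).1 := rfl
    have h6 : (q⁻¹ : SU2).1 * diagLie d = ψ' * (q⁻¹ : SU2).1 := by
      calc (q⁻¹ : SU2).1 * diagLie d = (q⁻¹ : SU2).1 * (diagLie d * q.1) * (q⁻¹ : SU2).1 := by
            rw [mul_assoc, mul_assoc, mul_inv_coe, mul_one]
        _ = _ := by rw [← h2, ← mul_assoc, inv_mul_coe, one_mul]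
    have h7 : (φ x).1 * ψ' = ψ x * (φ x).1 := by
      rw [h3, Ad, mul_assoc _ _ (φ x).1, inv_mul_coe, mul_one]
    rw [h5]
    calc (p x).1 * (φ x).1 * (q⁻¹ : SU2).1 * diagLie d
        = (p x).1 * ((φ x).1 * ψ') * (q⁻¹ : SU2).1 := by rw [mul_assoc _ _ (diagLie d), h6]; noncomm_ring
      _ = (p x).1 * ψ x * (φ x).1 * (q⁻¹ : SU2).1 := by rw [h7]; noncomm_ring
      _ = _ := by rw [h1]; noncomm_ring
  rw [← h4, hδ]
  group

/-! ### Integration by parts -/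

theorem integral_deriv_eq_zero {f f' : UnitAddCircle → ℂ}
    (hf : ∀ t : ℝ, HasDerivAt (fun s : ℝ => f s) (f' t) t) (hf' : Continuous f') :
    ∫ x, f' x = 0 := by
  rw [← UnitAddCircle.intervalIntegral_preimage 0 f',
    intervalIntegral.integral_eq_sub_of_hasDerivAt (f := fun s : ℝ => f s) (fun t _ => hf t)
      (hf'.comp (AddCircle.continuous_mk' 1)).continuousOn.intervalIntegrable]
  have : ((0 + 1 : ℝ) : UnitAddCircle) = ((0 : ℝ) : UnitAddCircle) := by
    simp
  simp only [this, sub_self]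

theorem IsC1Cocycle.cyc {α : ℝ} {φ : UnitAddCircle → SU2} (hφ : IsC1Cocycle φ) (n : ℕ) :
    IsC1Cocycle (cyc α φ n) := by
  induction n with
  | zero => intro i j; simp only [cocycleIter]; exact contDiff_const
  | succ n ih =>
    intro i j
    have h : ∀ i j, ContDiff ℝ 1 fun t : ℝ =>
        (φ ((t : UnitAddCircle) + n • (α : UnitAddCircle))).1 i j := fun i j => by
      have h1 := (hφ i j).comp (contDiff_id.add (contDiff_const (c := (n : ℝ) * α)))
      have h2 : (fun t : ℝ => (φ ((t : UnitAddCircle) + n • (α : UnitAddCircle))).1 i j) =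
          (fun t : ℝ => (φ (t : UnitAddCircle)).1 i j) ∘ fun t => id t + n * α := by
        funext t
        simp
      rw [h2]; exact h1
    simp only [cocycleIter, circleRotation_iterate, SU2_mul_apply]
    exact ((ih _ _).mul (h _ _)).add ((ih _ _).mul (h _ _))

theorem norm_SU2_apply_le (u : SU2) (i j : Fin 2) : ‖u.1 i j‖ ≤ 1 := by
  have h := SU2_unit u
  rw [Complex.mul_conj, Complex.mul_conj, Complex.normSq_eq_norm_sq, Complex.normSq_eq_norm_sq] at h
  have h1 : ‖u.1 0 0‖ ^ 2 + ‖u.1 0 1‖ ^ 2 = 1 := by exact_mod_cast h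
  obtain ⟨e1, e2⟩ := SU2_entries u
  have h2 : ‖u.1 0 0‖ ≤ 1 := by nlinarith [sq_nonneg ‖u.1 0 1‖, norm_nonneg (u.1 0 0)]
  have h3 : ‖u.1 0 1‖ ≤ 1 := by nlinarith [sq_nonneg ‖u.1 0 0‖, norm_nonneg (u.1 0 1)]
  fin_cases i <;> fin_cases j
  · exact h2
  · exact h3
  · change ‖u.1 1 0‖ ≤ 1
    rw [e2, norm_neg, RCLike.norm_conj]; exact h3
  · change ‖u.1 1 1‖ ≤ 1
    rw [e1, RCLike.norm_conj]; exact h2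

theorem norm_mul_SU2_apply_le (A : M) (u : SU2) (i j : Fin 2) :
    ‖(A * u.1) i j‖ ≤ 2 * ‖vec A‖ := by
  have h : ∀ k, ‖A i k * u.1 k j‖ ≤ ‖vec A‖ := fun k => by
    rw [norm_mul]
    have h1 : ‖A i k‖ ≤ ‖vec A‖ := PiLp.norm_apply_le (vec A) (i, k)
    have h2 := norm_SU2_apply_le u k j
    nlinarith [norm_nonneg (A i k), norm_nonneg (u.1 k j)]
  rw [Matrix.mul_apply, Fin.sum_univ_two]
  refine (norm_add_le _ _).trans ?_
  linarith [h 0, h 1]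

/-- The derivative of the monomial `∏ l, X (K l)` in the entries of `X` in direction `A X`. -/
def monomialDeriv {k : ℕ} (K : Fin k → Fin 2 × Fin 2) (A X : M) : ℂ :=
  ∑ l, (∏ j ∈ Finset.univ.erase l, X (K j).1 (K j).2) * (A * X) (K l).1 (K l).2

theorem norm_monomialDeriv_le {k : ℕ} (K : Fin k → Fin 2 × Fin 2) (A : M) (u : SU2) :
    ‖monomialDeriv K A u.1‖ ≤ k * (2 * ‖vec A‖) := by
  refine (norm_sum_le _ _).trans ((Finset.sum_le_card_nsmul _ _ (2 * ‖vec A‖) fun l _ => ?_).trans ?_)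
  · rw [norm_mul, norm_prod]
    have h1 : ∏ j ∈ Finset.univ.erase l, ‖u.1 (K j).1 (K j).2‖ ≤ 1 :=
      Finset.prod_le_one (fun _ _ => norm_nonneg _) fun _ _ => norm_SU2_apply_le _ _ _
    exact (mul_le_of_le_one_left (norm_nonneg _) h1).trans (norm_mul_SU2_apply_le _ _ _ _)
  · simp

theorem monomialDeriv_sub {k : ℕ} (K : Fin k → Fin 2 × Fin 2) (A B X : M) :
    monomialDeriv K (A - B) X = monomialDeriv K A X - monomialDeriv K B X := by
  simp only [monomialDeriv, ← Finset.sum_sub_distrib, sub_mul, Matrix.sub_apply, mul_sub]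

theorem continuous_meanLogDeriv {α : ℝ} {φ : UnitAddCircle → SU2} (hφ : IsC1Cocycle φ) (n : ℕ) :
    Continuous (meanLogDeriv α φ n) :=
  (continuous_logDeriv (hφ.cyc (α := α) n)).const_smul (n : ℂ)⁻¹

theorem continuous_monomialDeriv {k : ℕ} (K : Fin k → Fin 2 × Fin 2) :
    Continuous fun z : M × M => monomialDeriv K z.1 z.2 := by
  unfold monomialDeriv
  have h : ∀ i j, Continuous fun z : M × M => (z.1 * z.2) i j := fun i j =>
    (continuous_fst.matrix_mul continuous_snd).matrix_elem i j
  refine continuous_finsetSum _ fun l _ => (continuous_finsetProd _ fun j _ => ?_).mul (h _ _)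
  exact continuous_snd.matrix_elem _ _

attribute [irreducible] monomialDeriv

/-- The derivative of the monomial along the circle is `n` times `monomialDeriv`, and the monomial
is bounded by one. Integrating by parts moves the derivative to the character, at the cost of the
constant `2πim`. -/
theorem norm_integral_fourier_monomialDeriv_le {α : ℝ} {φ : UnitAddCircle → SU2}
    (hφ : IsC1Cocycle φ) {k : ℕ} (K : Fin k → Fin 2 × Fin 2) (m : ℤ) {n : ℕ} (hn : n ≠ 0) :
    ‖∫ x : UnitAddCircle, fourier m x * monomialDeriv K (meanLogDeriv α φ n x) (cyc α φ n x).1‖ ≤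
      ‖(2 * Real.pi * Complex.I * m : ℂ)‖ / n := by
  set X := fun x => (cyc α φ n x).1
  have hX : Continuous X := continuous_coe (hφ.cyc n)
  have hd : ∀ (t : ℝ) i j, HasDerivAt (fun s : ℝ => X s i j) (circleDeriv X t i j) t :=
    fun t i j => by
      rw [circleDeriv_coe]
      exact (((hφ.cyc (α := α) n i j).differentiable one_ne_zero) t).hasDerivAt
  have hn' : (n : ℂ) ≠ 0 := by exact_mod_cast hn
  have hD : ∀ x, circleDeriv X x = (n : ℂ) • (meanLogDeriv α φ n x * X x) := fun x => by
    rw [meanLogDeriv, smul_mul_assoc, smul_smul, mul_inv_cancel₀ hn', one_smul, mul_assoc,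
      inv_mul_coe, mul_one]
  have hprod : ∀ t : ℝ, HasDerivAt (fun s : ℝ => ∏ l, X s (K l).1 (K l).2)
      (n * monomialDeriv K (meanLogDeriv α φ n t) (X t)) t := fun t => by
    have h := HasDerivAt.fun_finsetProd (u := Finset.univ) fun l _ => hd t (K l).1 (K l).2
    refine h.congr_deriv ?_
    rw [monomialDeriv, Finset.mul_sum]
    refine Finset.sum_congr rfl fun l _ => ?_
    rw [hD, Matrix.smul_apply, smul_eq_mul, smul_eq_mul]
    ring
  set c : ℂ := 2 * Real.pi * Complex.I * m
  have hf : ∀ t : ℝ, HasDerivAt (fun s : ℝ => fourier m (s : UnitAddCircle)) (c * fourier m (t : UnitAddCircle)) t :=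
    fun t => by simpa using hasDerivAt_fourier 1 m t
  have hcP : Continuous fun x => ∏ l, X x (K l).1 (K l).2 :=
    continuous_finsetProd _ fun j _ => hX.matrix_elem _ _
  have hcR : Continuous fun x => monomialDeriv K (meanLogDeriv α φ n x) (X x) :=
    (continuous_monomialDeriv K).comp ((continuous_meanLogDeriv hφ n).prodMk hX)
  have hc1 : Continuous fun x => c * fourier m x * ∏ l, X x (K l).1 (K l).2 :=
    (continuous_const.mul (fourier m).continuous).mul hcP
  have hc2 : Continuous fun x => fourier m x * (n * monomialDeriv K (meanLogDeriv α φ n x) (X x)) :=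
    (fourier m).continuous.mul (continuous_const.mul hcR)
  have h0 := integral_deriv_eq_zero (fun t => (hf t).mul (hprod t)) (f := fun x =>
    fourier m x * ∏ l, X x (K l).1 (K l).2) (f' := fun x => c * fourier m x *
      (∏ l, X x (K l).1 (K l).2) + fourier m x *
        (n * monomialDeriv K (meanLogDeriv α φ n x) (X x))) (hc1.add hc2)
  have hint : ∀ f : UnitAddCircle → ℂ, Continuous f → Integrable f volume := fun f hf =>
    hf.integrable_of_hasCompactSupport (HasCompactSupport.of_compactSpace _)
  rw [integral_add (hint _ hc1) (hint _ hc2)] at h0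
  have h1 : ∫ x : UnitAddCircle, fourier m x * (n * monomialDeriv K (meanLogDeriv α φ n x) (X x)) =
      n * ∫ x : UnitAddCircle, fourier m x * monomialDeriv K (meanLogDeriv α φ n x) (X x) := by
    rw [← integral_const_mul]
    congr 1; funext x; ring
  rw [h1] at h0
  have h2 : ‖∫ x, c * fourier m x * ∏ l, X x (K l).1 (K l).2‖ ≤ ‖c‖ := by
    have := norm_integral_le_of_norm_le_const (μ := (volume : Measure UnitAddCircle)) (C := ‖c‖)
      (f := fun x => c * fourier m x * ∏ l, X x (K l).1 (K l).2) (ae_of_all _ fun x => by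
        rw [norm_mul, norm_mul, norm_fourier_apply, mul_one, norm_prod]
        exact mul_le_of_le_one_right (norm_nonneg _)
          (Finset.prod_le_one (fun _ _ => norm_nonneg _) fun _ _ => norm_SU2_apply_le _ _ _))
    simpa using this
  have h3 := congrArg norm (eq_neg_of_add_eq_zero_right h0)
  rw [norm_neg, norm_mul, Complex.norm_natCast] at h3
  rw [le_div_iff₀ (by positivity), mul_comm, h3]
  exact h2

/-! ### Replacing the logarithmic derivatives by their limit -/

theorem tendsto_eLpNorm_sub {α : ℝ} {φ : UnitAddCircle → SU2} {ψ : UnitAddCircle → M}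
    (hφ : IsC1Cocycle φ) (hm : ∀ i j, Measurable fun x => ψ x i j)
    (ht : Tendsto (fun n : ℕ => ∫⁻ x, ENNReal.ofReal (su2Norm (meanLogDeriv α φ n x - ψ x) ^ 2))
      atTop (𝓝 0)) :
    Tendsto (fun n : ℕ => ∫⁻ x, ‖vec (meanLogDeriv α φ n x - ψ x)‖ₑ) atTop (𝓝 0) := by
  have h1 : ∀ n, ∫⁻ x, ENNReal.ofReal (su2Norm (meanLogDeriv α φ n x - ψ x) ^ 2) =
      2⁻¹ * eLpNorm (fun x => vec (meanLogDeriv α φ n x - ψ x)) 2 volume ^ 2 := fun n =>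
    lintegral_eq _ _ (ae_of_all _ fun _ => rfl)
  simp only [h1] at ht
  have h2 := ENNReal.Tendsto.const_mul (a := 2) ht (Or.inr (by simp))
  simp only [← mul_assoc, ENNReal.mul_inv_cancel (two_ne_zero) (ENNReal.ofNat_ne_top), one_mul,
    mul_zero] at h2
  have h3 := ((ENNReal.continuous_rpow_const (y := (2 : ℝ)⁻¹)).tendsto 0).comp h2
  rw [ENNReal.zero_rpow_of_pos (by norm_num)] at h3
  refine tendsto_of_tendsto_of_tendsto_of_le_of_le tendsto_const_nhds h3 (fun _ => zero_le)
    fun n => ?_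
  have h4 : AEStronglyMeasurable (fun x => vec (meanLogDeriv α φ n x - ψ x)) volume :=
    ((continuous_vec.comp (continuous_meanLogDeriv hφ n)).measurable.sub
      (measurable_vec hm)).aestronglyMeasurable
  -- On a probability space the `L¹` norm is at most the `L²` norm.
  have h5 := eLpNorm_le_eLpNorm_of_exponent_le (p := 1) (q := 2) (by norm_num) h4
  rw [eLpNorm_one_eq_lintegral_enorm] at h5
  refine h5.trans (le_of_eq ?_)
  rw [Function.comp_apply, ← ENNReal.rpow_natCast, ← ENNReal.rpow_mul]
  norm_num

/-- `monomialDeriv` is additive and bounded in its direction, so passing from `R_n` to `ψ` costs an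
`L¹` error tending to zero, and the integration by parts bound handles `R_n`. Measurability and the
bound are kept for the integrability needed later. -/
theorem mixingMultipliers_monomialDeriv {α : ℝ} {φ : UnitAddCircle → SU2} {ψ : UnitAddCircle → M}
    {d : ℝ} (hφ : IsC1Cocycle φ) (hm : ∀ i j, Measurable fun x => ψ x i j)
    (ht : Tendsto (fun n : ℕ => ∫⁻ x, ENNReal.ofReal (su2Norm (meanLogDeriv α φ n x - ψ x) ^ 2))
      atTop (𝓝 0)) (hn : ∀ᵐ x, su2Norm (ψ x) = d) {k : ℕ} (K : Fin k → Fin 2 × Fin 2) :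
    (∀ n, AEStronglyMeasurable (fun x => monomialDeriv K (ψ x) (cyc α φ n x).1) volume) ∧
    (∀ n, ∀ᵐ x, ‖monomialDeriv K (ψ x) (cyc α φ n x).1‖ ≤ k * (2 * (√2 * d))) ∧
    MixingMultipliers α fun n x => monomialDeriv K (ψ x) (cyc α φ n x).1 := by
  have hX : ∀ n, Continuous fun x => (cyc α φ n x).1 := fun n => continuous_coe (hφ.cyc n)
  have hmeas : ∀ n, AEStronglyMeasurable (fun x => monomialDeriv K (ψ x) (cyc α φ n x).1) volume :=
    fun n => ((continuous_monomialDeriv K).comp ((continuous_unvec.comp continuous_fst).prodMk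
      (continuous_unvec.comp continuous_snd))).comp_aestronglyMeasurable
      ((measurable_vec hm).aestronglyMeasurable.prodMk
        (continuous_vec.comp (hX n)).aestronglyMeasurable)
  have hbd : ∀ n, ∀ᵐ x, ‖monomialDeriv K (ψ x) (cyc α φ n x).1‖ ≤ k * (2 * (√2 * d)) := fun n => by
    filter_upwards [hn] with x hx
    have := norm_monomialDeriv_le K (ψ x) (cyc α φ n x)
    rwa [norm_vec, hx] at this
  refine ⟨hmeas, hbd, mixingMultipliers_of_fourier hmeas hbd fun m => ?_⟩
  have h1 : Tendsto (fun n : ℕ =>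
      ∫ x : UnitAddCircle, fourier m x * monomialDeriv K (meanLogDeriv α φ n x) (cyc α φ n x).1) atTop (𝓝 0) := by
    refine squeeze_zero_norm' ?_ (tendsto_const_div_atTop_nhds_zero_nat
      ‖(2 * Real.pi * Complex.I * m : ℂ)‖)
    filter_upwards [eventually_ne_atTop 0] with n hn
    exact norm_integral_fourier_monomialDeriv_le hφ K m hn
  have h2 : Tendsto (fun n : ℕ => ∫ x : UnitAddCircle, fourier m x *
      monomialDeriv K (meanLogDeriv α φ n x - ψ x) (cyc α φ n x).1) atTop (𝓝 0) := by
    rw [tendsto_zero_iff_enorm_tendsto_zero]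
    have h3 := ENNReal.Tendsto.const_mul (a := ENNReal.ofReal (k * 2))
      (tendsto_eLpNorm_sub hφ hm ht) (Or.inr ENNReal.ofReal_ne_top)
    rw [mul_zero] at h3
    refine tendsto_of_tendsto_of_tendsto_of_le_of_le tendsto_const_nhds h3 (fun _ => zero_le)
      fun n => ?_
    refine (enorm_integral_le_lintegral_enorm _).trans ?_
    rw [← lintegral_const_mul' _ _ ENNReal.ofReal_ne_top]
    refine lintegral_mono fun x => ?_
    have h4 := norm_monomialDeriv_le K (meanLogDeriv α φ n x - ψ x) (cyc α φ n x)
    rw [← ofReal_norm, ← ofReal_norm, ← ENNReal.ofReal_mul (by positivity), norm_mul,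
      norm_fourier_apply, one_mul]
    exact ENNReal.ofReal_le_ofReal (by linarith)
  have h3 := h1.sub h2
  rw [sub_zero] at h3
  refine h3.congr fun n => ?_
  have hc : Continuous fun x => fourier m x *
      monomialDeriv K (meanLogDeriv α φ n x) (cyc α φ n x).1 :=
    (fourier m).continuous.mul
      ((continuous_monomialDeriv K).comp ((continuous_meanLogDeriv hφ n).prodMk (hX n)))
  have hi1 : Integrable (fun x => fourier m x *
      monomialDeriv K (meanLogDeriv α φ n x) (cyc α φ n x).1) volume :=
    hc.integrable_of_hasCompactSupport (HasCompactSupport.of_compactSpace _)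
  have hi2 : Integrable (fun x => fourier m x * monomialDeriv K (ψ x) (cyc α φ n x).1) volume := by
    refine Integrable.of_bound ((fourier m).continuous.aestronglyMeasurable.mul (hmeas n))
      (k * (2 * (√2 * d))) ?_
    filter_upwards [hbd n] with x hx
    rwa [norm_mul, norm_fourier_apply, one_mul]
  have h5 : ∀ x, fourier m x * monomialDeriv K (meanLogDeriv α φ n x - ψ x) (cyc α φ n x).1 =
      fourier m x * monomialDeriv K (meanLogDeriv α φ n x) (cyc α φ n x).1 -
        fourier m x * monomialDeriv K (ψ x) (cyc α φ n x).1 := fun x => by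
    rw [monomialDeriv_sub, mul_sub]
  simp only [h5]
  rw [integral_sub hi1 hi2, sub_sub_cancel]

/-! ### Contraction with eigenvectors -/

/-- Both sides are the derivative of `(∑ c m)^k` in direction `m'`; the left one comes from
expanding the power over words `K` first. -/
theorem sum_prod_mul_sum_erase {κ : Type*} [Fintype κ] [DecidableEq κ] (k : ℕ) (c m m' : κ → ℂ) :
    ∑ K : Fin k → κ, (∏ l, c (K l)) *
        ∑ l, (∏ j ∈ Finset.univ.erase l, m (K j)) * m' (K l) =
      k * ((∑ q, c q * m q) ^ (k - 1) * ∑ q, c q * m' q) := by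
  simp only [Finset.mul_sum (s := (Finset.univ : Finset (Fin k)))]
  rw [Finset.sum_comm]
  have h : ∀ l : Fin k, ∑ K : Fin k → κ, (∏ l, c (K l)) *
      ((∏ j ∈ Finset.univ.erase l, m (K j)) * m' (K l)) =
      (∑ q, c q * m q) ^ (k - 1) * ∑ q, c q * m' q := fun l => by
    have h1 : ∀ K : Fin k → κ, (∏ l, c (K l)) *
        ((∏ j ∈ Finset.univ.erase l, m (K j)) * m' (K l)) =
        ∏ j, (c (K j) * if j = l then m' (K j) else m (K j)) := fun K => by
      rw [Finset.prod_mul_distrib]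
      congr 1
      rw [← Finset.prod_erase_mul _ _ (Finset.mem_univ l), if_pos rfl]
      congr 1
      refine Finset.prod_congr rfl fun j hj => ?_
      rw [if_neg (Finset.ne_of_mem_erase hj)]
    simp only [h1]
    have h2 := Finset.prod_univ_sum (fun _ : Fin k => (Finset.univ : Finset κ))
      (fun j q => c q * if j = l then m' q else m q)
    rw [Fintype.piFinset_univ] at h2
    rw [← h2, ← Finset.prod_erase_mul _ _ (Finset.mem_univ l)]
    simp only [if_true]
    congr 1
    have h3 : ∀ j ∈ Finset.univ.erase l, (∑ q, c q * if j = l then m' q else m q) =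
        ∑ q, c q * m q := fun j hj => by
      simp only [if_neg (Finset.ne_of_mem_erase hj)]
    rw [Finset.prod_congr rfl h3, Finset.prod_const, Finset.card_erase_of_mem (Finset.mem_univ l)]
    simp
  simp only [h]
  simp

/-- With these coefficients the power in the previous identity becomes a power of the upper left
entry of `p A q⁻¹`. -/
theorem sum_contract (p q : SU2) (A : M) :
    ∑ z : Fin 2 × Fin 2, (p.1 0 z.1 * (q⁻¹).1 z.2 0) * A z.1 z.2 = (p.1 * A * (q⁻¹).1) 0 0 := by
  simp only [Fintype.sum_prod_type, Matrix.mul_apply, Fin.sum_univ_two]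
  ring

theorem memLp_mul_bounded {a u : UnitAddCircle → ℂ} {C : ℝ} (ha : MemLp a 2 volume)
    (hu : AEStronglyMeasurable u volume) (hC : ∀ᵐ x, ‖u x‖ ≤ C) :
    MemLp (fun x => a x * u x) 2 volume := by
  refine ha.of_le_mul (c := C) (ha.1.mul hu) ?_
  filter_upwards [hC] with x hx
  rw [norm_mul, mul_comm]
  exact mul_le_mul_of_nonneg_right hx (norm_nonneg _)

/-- The powers of the diagonal entries of a cocycle of nonzero degree are mixing multipliers. -/
theorem mixingMultipliers_pow {α : ℝ} {φ : UnitAddCircle → SU2} {ψ : UnitAddCircle → M}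
    {d : ℝ} (hd : d ≠ 0) (hφ : IsC1Cocycle φ) (hm : ∀ i j, Measurable fun x => ψ x i j)
    (ht : Tendsto (fun n : ℕ => ∫⁻ x, ENNReal.ofReal (su2Norm (meanLogDeriv α φ n x - ψ x) ^ 2))
      atTop (𝓝 0)) (hn : ∀ᵐ x, su2Norm (ψ x) = d)
    {p : UnitAddCircle → SU2} {γ : UnitAddCircle → Circle}
    (hp : ∀ i j, Measurable fun x => (p x).1 i j)
    (hcoh : ∀ᵐ x, φ x = (p x)⁻¹ * diagSU2 (γ x) * p (circleRotation α x))
    (hdiag : ∀ᵐ x, (p x).1 * ψ x = diagLie d * (p x).1) {k : ℕ} (hk : k ≠ 0) :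
    MixingMultipliers α fun n x => ((cocycleIter (circleRotation α) γ n x : Circle) : ℂ) ^ k := by
  intro a b ha hb
  have hmp := fun n => (measurePreserving_circleRotation α).iterate n
  -- The coefficient of the word `K` splits into a factor at `x`, absorbed in `a`, and a factor at
  -- `Tⁿ x`, absorbed in `b`.
  set u : (Fin k → Fin 2 × Fin 2) → UnitAddCircle → ℂ := fun K x => ∏ l, (p x).1 0 (K l).1
  set w : (Fin k → Fin 2 × Fin 2) → UnitAddCircle → ℂ :=
    fun K x => ∏ l, ((p x)⁻¹).1 (K l).2 0
  have hu : ∀ K, MemLp (fun x => a x * u K x) 2 volume := fun K =>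
    memLp_mul_bounded (C := 1) ha
      (Finset.measurable_prod _ fun l _ => hp _ _).aestronglyMeasurable
      (ae_of_all _ fun x => by
        rw [norm_prod]
        exact Finset.prod_le_one (fun _ _ => norm_nonneg _) fun _ _ => norm_SU2_apply_le _ _ _)
  have hw : ∀ K, MemLp (fun x => b x * w K x) 2 volume := fun K =>
    memLp_mul_bounded (C := 1) hb
      (Finset.measurable_prod _ fun l _ => measurable_inv_entries hp _ _).aestronglyMeasurable
      (ae_of_all _ fun x => by
        rw [norm_prod]
        exact Finset.prod_le_one (fun _ _ => norm_nonneg _) fun _ _ => norm_SU2_apply_le _ _ _)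
  have hR := fun K : Fin k → Fin 2 × Fin 2 =>
    mixingMultipliers_monomialDeriv (α := α) hφ hm ht hn K
  have h1 := tendsto_finsetSum Finset.univ
    fun K (_ : K ∈ Finset.univ) => (hR K).2.2 _ _ (hu K) (hw K)
  rw [Finset.sum_const_zero] at h1
  -- The contraction produces `k i d (γ^(n))^k`; dividing by this constant is where `d ≠ 0` and `k ≠
  -- 0` are used.
  set c : ℂ := k * (Complex.I * d)
  have hc : c ≠ 0 := by simp [c, hk, hd]
  have h2 := h1.const_mul c⁻¹
  rw [mul_zero] at h2
  refine h2.congr fun n => ?_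
  rw [← integral_finsetSum, ← integral_const_mul]
  · refine integral_congr_ae ?_
    filter_upwards [cocycleIter_of_cohomologous hcoh, hdiag] with x hx hx'
    rw [inv_mul_eq_iff_eq_mul₀ hc]
    set y := (circleRotation α)^[n] x
    set X := cyc α φ n x
    set z : Circle := cocycleIter (circleRotation α) γ n x
    have hX : p x * X * (p y)⁻¹ = diagSU2 z := by
      have hXx : X = (p x)⁻¹ * diagSU2 z * p y := by
        rw [← cocycleIter_diagSU2]; exact hx n
      rw [hXx]; group
    have e1 : ((p x).1 * X.1 * ((p y)⁻¹).1) 0 0 = (z : ℂ) :=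
      congrFun (congrFun (congrArg Subtype.val hX) 0) 0
    have e2 : ((p x).1 * (ψ x * X.1) * ((p y)⁻¹).1) 0 0 = Complex.I * d * (z : ℂ) := by
      have : (p x).1 * (ψ x * X.1) * ((p y)⁻¹).1 = diagLie d * ((p x).1 * X.1 * ((p y)⁻¹).1) := by
        calc (p x).1 * (ψ x * X.1) * ((p y)⁻¹).1
            = ((p x).1 * ψ x) * X.1 * ((p y)⁻¹).1 := by noncomm_ring
          _ = _ := by rw [hx']; noncomm_ring
      rw [this, Matrix.mul_apply, Fin.sum_univ_two, e1]
      simp [diagLie]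
    have h3 := sum_prod_mul_sum_erase k
      (fun z : Fin 2 × Fin 2 => (p x).1 0 z.1 * ((p y)⁻¹).1 z.2 0)
      (fun z => X.1 z.1 z.2) (fun z => (ψ x * X.1) z.1 z.2)
    rw [sum_contract, sum_contract, e1, e2] at h3
    have h4 : ∀ K : Fin k → Fin 2 × Fin 2,
        (a x * u K x) * (b y * w K y) * monomialDeriv K (ψ x) X.1 =
        a x * b y * ((∏ l, ((p x).1 0 (K l).1 * ((p y)⁻¹).1 (K l).2 0)) *
          ∑ l, (∏ j ∈ Finset.univ.erase l, X.1 (K j).1 (K j).2) *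
            (ψ x * X.1) (K l).1 (K l).2) := fun K => by
      rw [Finset.prod_mul_distrib]
      simp only [u, w, monomialDeriv]
      ring
    simp only [h4]
    rw [← Finset.mul_sum, h3]
    have h5 : (z : ℂ) ^ k = (z : ℂ) ^ (k - 1) * z := by
      rw [← pow_succ, Nat.sub_add_cancel (Nat.one_le_iff_ne_zero.2 hk)]
    rw [h5]
    ring
  · intro K _
    have h3 := memLp_mul_bounded ((hw K).comp_measurePreserving (hmp n)) ((hR K).1 n) ((hR K).2.1 n)
    have h4 := (hu K).integrable_mul h3
    refine h4.congr (ae_of_all _ fun x => ?_)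
    simp only [Pi.mul_apply, Function.comp_apply]
    ring

/-! ### Dependence on the transfer function -/

/-- Multiplying the relation by the conjugate of `f ∘ Tⁿ` solves it for `c² g_n`; after taking `k`th
powers, the factors at `x` and at `Tⁿ x` are bounded and go into `a` and `b`. -/
theorem MixingMultipliers.of_transfer {α : ℝ} {g₀ g : ℕ → UnitAddCircle → ℂ} {f : UnitAddCircle → ℂ}
    {c : ℝ} (hc : c ≠ 0) (hf : Measurable f) (hfc : ∀ᵐ x, ‖f x‖ = c)
    (h : ∀ᵐ x, ∀ n, f x * g₀ n x = g n x * f ((circleRotation α)^[n] x)) {k : ℕ}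
    (hg : MixingMultipliers α fun n x => g₀ n x ^ k) : MixingMultipliers α fun n x => g n x ^ k := by
  intro a b ha hb
  have hbd : ∀ᵐ x, ‖f x ^ k‖ ≤ c ^ k := by
    filter_upwards [hfc] with x hx
    rw [norm_pow, hx]
  have ha' := memLp_mul_bounded ha (hf.pow_const k).aestronglyMeasurable hbd
  have hb' := memLp_mul_bounded hb (u := fun x => conj (f x ^ k))
    (Complex.continuous_conj.measurable.comp (hf.pow_const k)).aestronglyMeasurable
    (hbd.mono fun x hx => by rwa [RCLike.norm_conj])
  have h1 := (hg _ _ ha' hb').const_mul (((c : ℂ) ^ 2) ^ k)⁻¹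
  rw [mul_zero] at h1
  refine h1.congr fun n => ?_
  rw [← integral_const_mul]
  refine integral_congr_ae ?_
  have h2 := ((measurePreserving_circleRotation α).iterate n).quasiMeasurePreserving.ae hfc
  filter_upwards [h, h2] with x h3 h4
  have h5 : f ((circleRotation α)^[n] x) * conj (f ((circleRotation α)^[n] x)) = (c : ℂ) ^ 2 := by
    rw [Complex.mul_conj, Complex.normSq_eq_norm_sq, h4]; push_cast; rfl
  have hc' : ((c : ℂ) ^ 2) ^ k ≠ 0 := by simp [hc]
  rw [inv_mul_eq_iff_eq_mul₀ hc', ← h5]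
  have h6 := congrArg (· ^ k) (h3 n)
  simp only [mul_pow] at h6
  simp only [mul_pow, map_pow]
  linear_combination (a x * b ((circleRotation α)^[n] x) *
    conj (f ((circleRotation α)^[n] x)) ^ k) * h6

theorem ae_norm_const {α : ℝ} (hα : Irrational α) {f : UnitAddCircle → ℂ} (hf : Measurable f)
    (h : ∀ᵐ x, ‖f (circleRotation α x)‖ = ‖f x‖) : ∃ c : ℝ, ∀ᵐ x, ‖f x‖ = c :=
  (ergodic_circleRotation hα).ae_eq_const_of_ae_eq_comp_ae
    hf.norm.aestronglyMeasurable h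

theorem diagSU2_apply_zero_zero (z : Circle) : (diagSU2 z).1 0 0 = z := rfl

theorem diagSU2_apply_zero_one (z : Circle) : (diagSU2 z).1 0 1 = 0 := rfl

theorem diagSU2_apply_one_zero (z : Circle) : (diagSU2 z).1 1 0 = 0 := rfl

theorem diagSU2_apply_one_one (z : Circle) : (diagSU2 z).1 1 1 = conj (z : ℂ) := rfl

/-- If one diagonalization of a cocycle gives mixing multipliers, so does any other. -/
theorem mixingMultipliers_of_cohomologous {α : ℝ} (hα : Irrational α) {φ p₀ p : UnitAddCircle → SU2}
    {γ₀ γ : UnitAddCircle → Circle}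
    (hp₀ : ∀ i j, Measurable fun x => (p₀ x).1 i j) (hp : ∀ i j, Measurable fun x => (p x).1 i j)
    (h₀ : ∀ᵐ x, φ x = (p₀ x)⁻¹ * diagSU2 (γ₀ x) * p₀ (circleRotation α x))
    (h : ∀ᵐ x, φ x = (p x)⁻¹ * diagSU2 (γ x) * p (circleRotation α x)) {k : ℕ}
    (hmix : MixingMultipliers α
      fun n x => ((cocycleIter (circleRotation α) γ₀ n x : Circle) : ℂ) ^ k) :
    MixingMultipliers α fun n x => ((cocycleIter (circleRotation α) γ n x : Circle) : ℂ) ^ k := by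
  -- `q` intertwines the two diagonal cocycles. Its entry `q₀₀` relates `γ₀` to `γ`, its entry `q₀₁`
  -- relates the conjugate of `γ₀` to `γ`; by ergodicity each has constant modulus.
  set q : UnitAddCircle → SU2 := fun x => p x * (p₀ x)⁻¹
  have hq : ∀ i j, Measurable fun x => (q x).1 i j :=
    measurable_mul_entries hp (measurable_inv_entries hp₀)
  have hrel : ∀ᵐ x, ∀ n, q x * diagSU2 (cocycleIter (circleRotation α) γ₀ n x) =
      diagSU2 (cocycleIter (circleRotation α) γ n x) * q ((circleRotation α)^[n] x) := by
    filter_upwards [cocycleIter_of_cohomologous h₀, cocycleIter_of_cohomologous h] with x h1 h2 n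
    have h3 := (h1 n).symm.trans (h2 n)
    rw [cocycleIter_diagSU2, cocycleIter_diagSU2] at h3
    have h4 : diagSU2 (cocycleIter (circleRotation α) γ₀ n x) =
        p₀ x * ((p x)⁻¹ * diagSU2 (cocycleIter (circleRotation α) γ n x) *
          p ((circleRotation α)^[n] x)) * (p₀ ((circleRotation α)^[n] x))⁻¹ := by
      rw [← h3]; group
    rw [h4]
    simp only [q]
    group
  have h00 : ∀ᵐ x, ∀ n, (q x).1 0 0 * ((cocycleIter (circleRotation α) γ₀ n x : Circle) : ℂ) =
      ((cocycleIter (circleRotation α) γ n x : Circle) : ℂ) *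
        (q ((circleRotation α)^[n] x)).1 0 0 := by
    filter_upwards [hrel] with x hx n
    have h1 := congrFun (congrFun (congrArg Subtype.val (hx n)) 0) 0
    rw [SU2_mul_apply (q x), SU2_mul_apply (diagSU2 _)] at h1
    simpa only [diagSU2_apply_zero_zero, diagSU2_apply_zero_one, diagSU2_apply_one_zero,
      diagSU2_apply_one_one, mul_zero, zero_mul, add_zero, zero_add] using h1
  have h01 : ∀ᵐ x, ∀ n, (q x).1 0 1 *
      conj ((cocycleIter (circleRotation α) γ₀ n x : Circle) : ℂ) =
      ((cocycleIter (circleRotation α) γ n x : Circle) : ℂ) *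
        (q ((circleRotation α)^[n] x)).1 0 1 := by
    filter_upwards [hrel] with x hx n
    have h1 := congrFun (congrFun (congrArg Subtype.val (hx n)) 0) 1
    rw [SU2_mul_apply (q x), SU2_mul_apply (diagSU2 _)] at h1
    simpa only [diagSU2_apply_zero_zero, diagSU2_apply_zero_one, diagSU2_apply_one_zero,
      diagSU2_apply_one_one, mul_zero, zero_mul, add_zero, zero_add] using h1
  obtain ⟨c, hc⟩ := ae_norm_const hα (hq 0 0) (by
    filter_upwards [h00] with x hx
    have := congrArg norm (hx 1)
    simpa only [norm_mul, RCLike.norm_conj, Circle.norm_coe, one_mul, mul_one,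
      Function.iterate_one] using this.symm)
  by_cases hc0 : c = 0
  · obtain ⟨e, he⟩ := ae_norm_const hα (hq 0 1) (by
      filter_upwards [h01] with x hx
      have := congrArg norm (hx 1)
      simpa only [norm_mul, RCLike.norm_conj, Circle.norm_coe, one_mul, mul_one,
      Function.iterate_one] using this.symm)
    -- The first row of `q` is a unit vector, so both entries cannot vanish.
    have he0 : e ≠ 0 := by
      rintro rfl
      obtain ⟨x, h1, h2⟩ := (hc.and he).exists
      have h3 := SU2_unit (q x)
      rw [hc0, norm_eq_zero] at h1
      rw [norm_eq_zero] at h2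
      simp [h1, h2] at h3
    refine MixingMultipliers.of_transfer he0 (hq 0 1) he h01 ?_
    simpa only [map_pow] using hmix.conj
  · exact MixingMultipliers.of_transfer hc0 (hq 0 0) hc h00 hmix

theorem mixingMultipliers_zpow {α : ℝ} {γ : UnitAddCircle → Circle}
    (h : ∀ k : ℕ, k ≠ 0 → MixingMultipliers α
      fun n x => ((cocycleIter (circleRotation α) γ n x : Circle) : ℂ) ^ k) {k : ℤ} (hk : k ≠ 0) :
    MixingMultipliers α
      fun n x => ((cocycleIter (circleRotation α) γ n x ^ k : Circle) : ℂ) := by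
  obtain ⟨m, rfl | rfl⟩ := k.eq_nat_or_neg
  · simpa using h m (by simpa using hk)
  · have := (h m (by simpa using hk)).conj
    simpa only [zpow_neg, zpow_natCast, Circle.coe_inv_eq_conj, Circle.coe_pow] using this

/-! ### The skew product on the torus -/

theorem skewProduct_iterate {X G : Type*} [Group G] (T : X → X) (φ : X → G) (n : ℕ) (z : X × G) :
    (skewProduct T φ)^[n] z = (T^[n] z.1, z.2 * cocycleIter T φ n z.1) := by
  induction n with
  | zero => simp [cocycleIter]
  | succ n ih =>
    rw [Function.iterate_succ_apply', ih, skewProduct, cocycleIter, Function.iterate_succ_apply',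
      mul_assoc]

theorem coeFn_koopman {X Y : Type*} [MeasurableSpace X] [MeasurableSpace Y] {μ : Measure X}
    {ν : Measure Y} {S : X → Y} (hS : MeasurePreserving S μ ν) (f : Lp ℂ 2 ν) :
    koopman hS f =ᵐ[μ] f ∘ S :=
  Lp.coeFn_compMeasurePreserving f hS

theorem koopman_iterate {X : Type*} [MeasurableSpace X] {μ : Measure X} {S : X → X}
    (hS : MeasurePreserving S μ μ) (n : ℕ) (f : Lp ℂ 2 μ) :
    (koopman hS)^[n] f = koopman (hS.iterate n) f := by
  refine Lp.ext (EventuallyEq.trans ?_ (coeFn_koopman _ _).symm)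
  induction n generalizing f with
  | zero => exact ae_of_all _ fun x => rfl
  | succ n ih =>
    rw [Function.iterate_succ_apply]
    refine (ih _).trans ?_
    have h := (hS.iterate n).quasiMeasurePreserving.ae_eq_comp (coeFn_koopman hS f)
    refine h.trans (ae_of_all _ fun x => ?_)
    simp only [Function.comp_apply, ← Function.iterate_succ_apply']

theorem coeFn_torusCharLp (i : ℤ × ℤ) : torusCharLp i =ᵐ[torusMeasure] torusChar i :=
  ContinuousMap.coeFn_toLp _ _

theorem coeFn_circleCharLp (m : ℤ) :
    circleCharLp m =ᵐ[volume] (fourier m : UnitAddCircle → ℂ) :=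
  ContinuousMap.coeFn_toLp _ _

/-- Translation by an element `w` with `w^k = -1` changes the sign of the integral. -/
theorem integral_zpow_circleHaar {k : ℤ} (hk : k ≠ 0) :
    ∫ z, ((z ^ k : Circle) : ℂ) ∂circleHaar = 0 := by
  set w : Circle := Circle.exp (Real.pi / k)
  have hw : ((w ^ k : Circle) : ℂ) = -1 := by
    have hk' : (k : ℝ) ≠ 0 := by exact_mod_cast hk
    rw [← Circle.exp_zsmul]
    simp only [zsmul_eq_mul, mul_div_cancel₀ _ hk', Circle.coe_exp, Complex.exp_pi_mul_I]
  have h := integral_mul_left_eq_self (μ := circleHaar) (fun z : Circle => ((z ^ k : Circle) : ℂ)) w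
  simp only [mul_zpow, Circle.coe_mul _ _, hw, integral_const_mul] at h
  linear_combination (-1 / 2 : ℂ) * h

theorem torusCharLp_mem_firstVariableFunctions (m : ℤ) :
    torusCharLp (m, 0) ∈ firstVariableFunctions := by
  refine ⟨circleCharLp m, ?_⟩
  refine Lp.ext ?_
  have hfst : MeasurePreserving (Prod.fst : UnitAddCircle × Circle → UnitAddCircle)
    torusMeasure volume := measurePreserving_fst
  refine (coeFn_koopman hfst _).trans ?_
  filter_upwards [hfst.quasiMeasurePreserving.ae (coeFn_circleCharLp m), coeFn_torusCharLp (m, 0)]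
    with z h1 h2
  rw [Function.comp_apply, h1, h2]
  simp [torusChar_apply]

theorem torusCharLp_mem_orthogonal {i : ℤ × ℤ} (hi : i.2 ≠ 0) :
    torusCharLp i ∈ firstVariableFunctionsᗮ := by
  rw [Submodule.mem_orthogonal]
  rintro _ ⟨h, rfl⟩
  rw [L2.inner_def]
  have hfst : MeasurePreserving (Prod.fst : UnitAddCircle × Circle → UnitAddCircle)
    torusMeasure volume := measurePreserving_fst
  have h1 : ∫ z, inner ℂ ((koopman hfst h : Lp ℂ 2 torusMeasure) z) (torusCharLp i z) ∂torusMeasure =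
      ∫ z : UnitAddCircle × Circle, (fourier i.1 z.1 * conj (h z.1)) * ((z.2 ^ i.2 : Circle) : ℂ)
        ∂torusMeasure := by
    refine integral_congr_ae ?_
    filter_upwards [coeFn_koopman hfst h, coeFn_torusCharLp i] with z h2 h3
    rw [h2, h3, torusChar_apply, RCLike.inner_apply, Function.comp_apply]
    ring
  refine h1.trans ?_
  rw [torusMeasure, integral_prod_mul (fun x => fourier i.1 x * conj (h x))
    (fun z : Circle => ((z ^ i.2 : Circle) : ℂ)), integral_zpow_circleHaar hi, mul_zero]

section Skew

variable {α : ℝ} {γ : UnitAddCircle → Circle} (hγ : Measurable γ)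

theorem coeFn_koopman_torusCharLp (n : ℕ) (j : ℤ × ℤ) :
    koopman ((measurePreserving_skewProduct α hγ).iterate n) (torusCharLp j) =ᵐ[torusMeasure]
      fun z => fourier j.1 (n • (α : UnitAddCircle)) * (fourier j.1 z.1 *
        ((cocycleIter (circleRotation α) γ n z.1 ^ j.2 : Circle) : ℂ) *
          ((z.2 ^ j.2 : Circle) : ℂ)) := by
  have hS := (measurePreserving_skewProduct α hγ).iterate n
  filter_upwards [coeFn_koopman hS (torusCharLp j),
    hS.quasiMeasurePreserving.ae (coeFn_torusCharLp j)] with z h1 h2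
  rw [h1, Function.comp_apply, h2, skewProduct_iterate, torusChar_apply, circleRotation_iterate,
    fourier_apply_add, mul_zpow, Circle.coe_mul]
  ring

/-- By Fubini the inner product is a base integral of mixing type times a fibre integral independent
of `n`, so the fibre frequencies need not be compared. -/
theorem tendsto_inner_koopman_torusCharLp
    (hmix : ∀ k : ℤ, k ≠ 0 → MixingMultipliers α
      fun n x => ((cocycleIter (circleRotation α) γ n x ^ k : Circle) : ℂ))
    (i : ℤ × ℤ) {j : ℤ × ℤ} (hj : j.2 ≠ 0) :
    Tendsto (fun n => inner ℂ (torusCharLp i)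
      (koopman ((measurePreserving_skewProduct α hγ).iterate n) (torusCharLp j))) atTop (𝓝 0) := by
  have hf : ∀ m : ℤ, MemLp (fourier m : UnitAddCircle → ℂ) 2 volume := fun m =>
    (fourier m).continuous.memLp_of_hasCompactSupport (HasCompactSupport.of_compactSpace _)
  have h1 := (hmix j.2 hj _ _ (hf (-i.1)) (hf j.1)).mul_const
    (∫ z, ((z ^ (j.2 - i.2) : Circle) : ℂ) ∂circleHaar)
  rw [zero_mul] at h1
  refine h1.congr fun n => ?_
  rw [L2.inner_def, ← integral_prod_mul (μ := (volume : Measure UnitAddCircle)) (ν := circleHaar)]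
  refine integral_congr_ae ?_
  filter_upwards [coeFn_torusCharLp i, coeFn_koopman_torusCharLp hγ n j] with z h2 h3
  rw [h2, h3, torusChar_apply, RCLike.inner_apply, circleRotation_iterate, fourier_apply_add,
    zpow_sub, Circle.coe_mul, Circle.coe_inv_eq_conj, map_mul, fourier_neg]
  ring

theorem isMixingOn_skewProduct
    (hmix : ∀ k : ℤ, k ≠ 0 → MixingMultipliers α
      fun n x => ((cocycleIter (circleRotation α) γ n x ^ k : Circle) : ℂ)) :
    IsMixingOn (koopman (measurePreserving_skewProduct α hγ)) firstVariableFunctionsᗮ := by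
  intro f hf
  have hS := (measurePreserving_skewProduct α hγ).iterate
  -- Composing with the projection allows testing on all characters of the torus: those with zero
  -- fibre frequency are killed by `P`, the others are fixed by it.
  set P := firstVariableFunctionsᗮ.starProjection
  have h := tendsto_inner_of_total (fun n => (koopman (hS n)).toContinuousLinearMap.comp P)
    (fun n => ?_) torusCharLp span_torusCharLp_closure_eq_top (fun i j => ?_) f f
  · refine h.congr fun n => ?_
    rw [koopman_iterate, ContinuousLinearMap.comp_apply, Submodule.starProjection_eq_self_iff.2 hf]
    rfl
  · refine (ContinuousLinearMap.opNorm_comp_le _ _).trans ?_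
    exact mul_le_one₀ (LinearIsometry.norm_toContinuousLinearMap_le _) (norm_nonneg _)
      (Submodule.starProjection_norm_le _)
  · by_cases hj : j.2 = 0
    · have h0 : P (torusCharLp j) = 0 := by
        rw [Submodule.starProjection_apply_eq_zero_iff]
        refine Submodule.le_orthogonal_orthogonal _ ?_
        have : j = (j.1, 0) := Prod.ext rfl hj
        rw [this]
        exact torusCharLp_mem_firstVariableFunctions _
      simp [h0]
    · refine (tendsto_inner_koopman_torusCharLp hγ hmix i hj).congr fun n => ?_
      rw [ContinuousLinearMap.comp_apply,
        Submodule.starProjection_eq_self_iff.2 (torusCharLp_mem_orthogonal hj)]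
      rfl

theorem fourier_ne_one (hα : Irrational α) {m : ℤ} (hm : m ≠ 0) :
    fourier m (α : UnitAddCircle) ≠ 1 := by
  intro h
  rw [fourier_apply, Circle.coe_eq_one, ← AddCircle.toCircle_zero (T := 1)] at h
  have h1 := AddCircle.injective_toCircle one_ne_zero h
  rw [← AddCircle.coe_zsmul, AddCircle.coe_eq_zero_iff] at h1
  obtain ⟨n, hn⟩ := h1
  refine hα ⟨(n : ℚ) / m, ?_⟩
  have hm' : (m : ℝ) ≠ 0 := by exact_mod_cast hm
  simp only [zsmul_eq_mul, mul_one] at hn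
  push_cast
  rw [hn]
  field_simp

/-- For zero fibre frequency the character is an eigenvector with eigenvalue different from one,
hence orthogonal to invariant vectors. Otherwise its iterates tend weakly to zero, while their inner
products with the invariant `f` do not depend on `n`. -/
theorem inner_torusCharLp_of_invariant (hα : Irrational α)
    (hmix : ∀ k : ℤ, k ≠ 0 → MixingMultipliers α
      fun n x => ((cocycleIter (circleRotation α) γ n x ^ k : Circle) : ℂ))
    {f : Lp ℂ 2 torusMeasure} (hf : koopman (measurePreserving_skewProduct α hγ) f = f)
    {j : ℤ × ℤ} (hj : j ≠ 0) : inner ℂ (torusCharLp j) f = 0 := by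
  have hS := (measurePreserving_skewProduct α hγ).iterate
  have hfn : ∀ n, koopman (hS n) f = f := fun n => by
    rw [← koopman_iterate (measurePreserving_skewProduct α hγ)]
    exact Function.iterate_fixed hf n
  by_cases hj2 : j.2 = 0
  · have hj1 : j.1 ≠ 0 := fun h => hj (Prod.ext h hj2)
    have h1 : koopman (hS 1) (torusCharLp j) = fourier j.1 (α : UnitAddCircle) • torusCharLp j := by
      refine Lp.ext ?_
      filter_upwards [coeFn_koopman_torusCharLp (α := α) hγ 1 j, coeFn_torusCharLp j,
        Lp.coeFn_smul (fourier j.1 (α : UnitAddCircle)) (torusCharLp j)] with z h2 h3 h4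
      rw [h2, h4, Pi.smul_apply, h3, torusChar_apply, hj2]
      simp
    have h2 : inner ℂ (torusCharLp j) f =
        conj (fourier j.1 (α : UnitAddCircle)) * inner ℂ (torusCharLp j) f := by
      conv_lhs => rw [← LinearIsometry.inner_map_map (koopman (hS 1)), hfn, h1, inner_smul_left]
    have h3 : (1 - conj (fourier j.1 (α : UnitAddCircle))) * inner ℂ (torusCharLp j) f = 0 := by
      linear_combination h2
    refine (mul_eq_zero.1 h3).resolve_left fun h4 => fourier_ne_one hα hj1 ?_
    have h5 := congrArg conj (sub_eq_zero.1 h4)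
    rw [map_one, Complex.conj_conj] at h5
    exact h5.symm
  · have h1 := tendsto_inner_of_total_right
      (fun n => koopman (hS n) (torusCharLp j)) (fun _ => .id ℂ _) ‖torusCharLp j‖
      (fun n => (LinearIsometry.norm_map _ _).le)
      (fun _ => ContinuousLinearMap.norm_id_le) torusCharLp span_torusCharLp_closure_eq_top
      (fun i => by
        have := (Complex.continuous_conj.tendsto 0).comp
          (tendsto_inner_koopman_torusCharLp hγ hmix i hj2)
        simpa [Function.comp_def] using this) f
    have h2 : ∀ n, inner ℂ (koopman (hS n) (torusCharLp j)) (ContinuousLinearMap.id ℂ _ f) =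
        inner ℂ (torusCharLp j) f := fun n => by
      rw [ContinuousLinearMap.id_apply]
      conv_lhs => rw [← hfn n, LinearIsometry.inner_map_map]
    simp only [h2] at h1
    exact tendsto_nhds_unique tendsto_const_nhds h1

theorem torusCharLp_zero_ae : torusCharLp 0 =ᵐ[torusMeasure] fun _ => (1 : ℂ) := by
  filter_upwards [coeFn_torusCharLp 0] with z h
  rw [h]; simp [torusChar_apply]

theorem ergodic_skewProduct {α : ℝ} {γ : UnitAddCircle → Circle} (hγ : Measurable γ) (hα : Irrational α)
    (hmix : ∀ k : ℤ, k ≠ 0 → MixingMultipliers α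
      fun n x => ((cocycleIter (circleRotation α) γ n x ^ k : Circle) : ℂ)) :
    Ergodic (skewProduct (circleRotation α) γ) torusMeasure := by
  have hS := measurePreserving_skewProduct α hγ
  refine ⟨hS, ⟨fun s hs hinv => ?_⟩⟩
  set f : Lp ℂ 2 torusMeasure := indicatorConstLp 2 hs (measure_ne_top _ _) 1
  have hfs : f =ᵐ[torusMeasure] s.indicator fun _ => (1 : ℂ) := indicatorConstLp_coeFn
  have hf : koopman hS f = f := by
    refine Lp.ext ?_
    filter_upwards [coeFn_koopman hS f, hfs, hS.quasiMeasurePreserving.ae hfs] with z h1 h2 h3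
    rw [h1, Function.comp_apply, h3, h2]
    have : skewProduct (circleRotation α) γ z ∈ s ↔ z ∈ s := by
      conv_rhs => rw [← hinv]
      rfl
    by_cases hz : z ∈ s
    · rw [Set.indicator_of_mem hz, Set.indicator_of_mem (this.2 hz)]
    · rw [Set.indicator_of_notMem hz, Set.indicator_of_notMem fun h => hz (this.1 h)]
  -- The constant function is invariant too, so its orthogonality to the other characters comes from
  -- the same lemma.
  have h0 : koopman hS (torusCharLp 0) = torusCharLp 0 := by
    refine Lp.ext ?_
    filter_upwards [coeFn_koopman hS (torusCharLp 0), torusCharLp_zero_ae,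
      hS.quasiMeasurePreserving.ae torusCharLp_zero_ae] with z h1 h2 h3
    rw [h1, Function.comp_apply, h3, h2]
  have h00 : inner ℂ (torusCharLp 0) (torusCharLp 0) = (1 : ℂ) := by
    rw [L2.inner_def]
    have : ∫ z, inner ℂ (torusCharLp 0 z) (torusCharLp 0 z) ∂torusMeasure =
        ∫ _, (1 : ℂ) ∂torusMeasure := by
      refine integral_congr_ae ?_
      filter_upwards [torusCharLp_zero_ae] with z h
      rw [h]; simp
    rw [this]; simp
  set c := inner ℂ (torusCharLp 0) f
  -- The indicator of an invariant set is orthogonal to all nontrivial characters, so it is the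
  -- constant `c`; its values then force the set to be null or conull.
  have hg : f - c • torusCharLp 0 = 0 := by
    refine eq_zero_of_inner_total torusCharLp span_torusCharLp_closure_eq_top _ fun j => ?_
    rw [inner_sub_right, inner_smul_right]
    by_cases hj : j = 0
    · rw [hj, h00, mul_one, sub_self]
    · rw [inner_torusCharLp_of_invariant hγ hα hmix hf hj,
        inner_torusCharLp_of_invariant hγ hα hmix h0 hj, mul_zero, sub_zero]
  have hfc : ∀ᵐ z ∂torusMeasure, s.indicator (fun _ => (1 : ℂ)) z = c := by
    rw [sub_eq_zero] at hg
    filter_upwards [hfs, Lp.coeFn_smul c (torusCharLp 0), torusCharLp_zero_ae] with z h1 h2 h3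
    rw [← h1, hg, h2, Pi.smul_apply, h3, smul_eq_mul, mul_one]
  rw [eventuallyConst_set']
  by_cases hc : c = 1
  · right
    rw [eventuallyEq_univ]
    filter_upwards [hfc] with z hz
    by_contra h
    rw [Set.indicator_of_notMem h, hc] at hz
    exact zero_ne_one hz
  · left
    rw [eventuallyEq_empty]
    filter_upwards [hfc] with z hz h
    rw [Set.indicator_of_mem h] at hz
    exact hc hz.symm

end Skew

end

/-! ### The theorem -/

theorem theorem5p3 (α : ℝ) (hα : Irrational α) (φ : UnitAddCircle → SU2) (hφ : IsC1Cocycle φ)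
    (hd : cocycleDegree hα hφ ≠ 0) :
    (∃ γ : UnitAddCircle → Circle, Measurable γ ∧
      IsCohomologous α φ (fun x => diagSU2 (γ x))) ∧
    ∀ (γ : UnitAddCircle → Circle) (hγ : Measurable γ),
      IsCohomologous α φ (fun x => diagSU2 (γ x)) →
      Ergodic (skewProduct (circleRotation α) γ) torusMeasure ∧
      IsMixingOn (koopman (measurePreserving_skewProduct α hγ)) firstVariableFunctionsᗮ ∧
      ∀ k : ℤ, k ≠ 0 →
        Tendsto (fun n : ℕ =>
          ∫ x : UnitAddCircle, ((cocycleIter (circleRotation α) γ n x ^ k : Circle) : ℂ))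
          atTop (𝓝 0) := by
  obtain ⟨ψ, hm, ht, hn, hinv, hs⟩ := exists_invariant_limit hα hφ
  obtain ⟨p₀, γ₀, hp₀, hγ₀, hcoh₀, hdiag⟩ := exists_diagonalization hd hm
    (fun i j => ((DegreeExistence.continuous_coe hφ).matrix_elem i j).measurable) hn hinv hs
  refine ⟨⟨γ₀, hγ₀, p₀, hp₀, hcoh₀⟩, fun γ hγ ⟨p, hp, hcoh⟩ => ?_⟩
  -- The mixing property is proved for the diagonalization built from `ψ` and transported to the
  -- given `γ`, whose transfer function need not diagonalize `ψ` in the same order.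
  have hmix : ∀ k : ℤ, k ≠ 0 → MixingMultipliers α
      fun n x => ((cocycleIter (circleRotation α) γ n x ^ k : Circle) : ℂ) := fun k hk =>
    mixingMultipliers_zpow (fun k hk => mixingMultipliers_of_cohomologous hα hp₀ hp hcoh₀ hcoh
      (mixingMultipliers_pow hd hφ hm ht hn hp₀ hcoh₀ hdiag hk)) hk
  refine ⟨ergodic_skewProduct hγ hα hmix, isMixingOn_skewProduct hγ hmix, fun k hk => ?_⟩
  have h := hmix k hk (fun _ => 1) (fun _ => 1) (memLp_const 1) (memLp_const 1)
  simpa only [one_mul] using h
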